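/- Let $k$ be a commutative ring and $A$ a commutative $k$-algebra. For $p\ge 0$, a non-empty co-ideal $\Delta\subset\mathbb{N}^p$ is a non-empty subset such that $\alpha\in\Delta$, $\alpha'\le\alpha$ (componentwise) imply $\alpha'\in\Delta$. Put $|\alpha|=\alpha_1+\dots+\alpha_p$, and let $A[[\mathbf s]]_\Delta$ ($\mathbf s=\{s_1,\dots,s_p\}$) be the quotient of $A[[\mathbf s]]$ by the ideal of the series whose support does not meet $\Delta$. A $(p,\Delta)$-variate Hasse–Schmidt derivation of $A$ over $k$ is a family $D=(D_\alpha)_{\alpha\in\Delta}$ of $k$-linear maps $A\to A$ with $D_0=\mathrm{Id}$ and $D_\alpha(xy)=\sum_{\beta+\gamma=\alpha}D_\beta(x)D_\gamma(y)$; their set $\mathrm{HS}^p_k(A;\Delta)$ is a group under $(D\circ E)_\alpha=\sum_{\beta+\gamma=\alpha}D_\beta\circ E_\gamma$, with identity $\mathbb I$ ($\mathbb I_0=\mathrm{Id}$, $\mathbb I_\alpha=0$ for $\alpha\ne0$). For $\alpha\in\Delta$ put $\ell_\alpha(D)=\min\{|\beta| : \beta\le\alpha,\ |\beta|\ge1,\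 D_\beta\neq0\}$, and $\ell_\alpha(D)=\infty$ if there is no such $\beta$. For a non-empty co-ideal $\nabla\subset\mathbb{N}^q$, a substitution map is an $A$-algebra map $\varphi:A[[\mathbf s]]_\Delta\to A[[\mathbf t]]_\nabla$ ($\mathbf t=\{t_1,\dots,t_q\}$) such that every $\varphi(s_i)$ has order $\ge1$; $\mathbf C_\beta(\varphi,\alpha)$ denotes the coefficient of $\mathbf t^\beta$ in $\varphi(\mathbf s^\alpha)$, and $\varphi\bullet D\in\mathrm{HS}^q_k(A;\nabla)$ is given by $(\varphi\bullet D)_\beta=\sum_{\alpha\in\Delta,|\alpha|\le|\beta|}\mathbf C_\beta(\varphi,\alpha)D_\alpha$. Let $\mathbb T_{A/k}$ be the free $k$-algebra on the variables $S_a$ ($a\in A$) and $T_{p,\Delta,D,\alpha}$ ($p\in\mathbb N$, $\Delta\subset\mathbb N^p$ a non-empty co-ideal, $D\in\mathrm{HS}^p_k(A;\Delta)$, $\alpha\in\Delta$), and let $\mathbb U_{A/k}=\mathbb T_{A/k}/\mathbb I_{A/k}$, where $\mathbb I_{A/k}$ is the two-sided ideal generated by (0) $S_{c1}-c$, $S_{a+a'}-S_a-S_{a'}$,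 $S_{aa'}-S_aS_{a'}$; (i) $T_{p,\{0\},\mathbb I,0}-1$; (ii) $T_{p,\Delta,\mathbb I,\alpha}$ for $|\alpha|>0$; (iii) $T_{p,\Delta,D\circ E,\alpha}-\sum_{\beta+\gamma=\alpha}T_{p,\Delta,D,\beta}T_{p,\Delta,E,\gamma}$; (iv) $T_{p,\Delta,D,\alpha}S_a-\sum_{\beta+\gamma=\alpha}S_{D_\beta(a)}T_{p,\Delta,D,\gamma}$; (v) $T_{q,\nabla,\varphi\bullet D,\beta}-\sum_{\alpha\in\Delta,|\alpha|\le|\beta|}S_{\mathbf C_\beta(\varphi,\alpha)}T_{p,\Delta,D,\alpha}$, for all $c\in k$, $a,a'\in A$, $p,q\in\mathbb N$, non-empty co-ideals $\Delta\subset\mathbb N^p$, $\nabla\subset\mathbb N^q$, $\alpha\in\Delta$, $\beta\in\nabla$, $D,E\in\mathrm{HS}^p_k(A;\Delta)$ and substitution maps $\varphi:A[[\mathbf s]]_\Delta\to A[[\mathbf t]]_\nabla$. Grade $\mathbb T_{A/k}$ by $\deg S_a=0$ and $\deg T_{p,\Delta,D,\alpha}=\lfloor|\alpha|/\ell_\alpha(D)\rfloor$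 (which is $0$ if $\ell_\alpha(D)=\infty$), let $\mathbb U^{d}_{A/k}$ be the image in $\mathbb U_{A/k}$ of the elements of degree $\le d$ ($\mathbb U^{-1}_{A/k}=0$), and let $\operatorname{gr}\mathbb U_{A/k}=\bigoplus_{d\ge0}\mathbb U^{d}_{A/k}/\mathbb U^{d-1}_{A/k}$. Theorem. The graded ring $\operatorname{gr}\mathbb U_{A/k}$ is commutative. Equivalently, for any two of the variables $x,y$ generating $\mathbb T_{A/k}$, with classes $\bar x,\bar y\in\mathbb U_{A/k}$, one has $\bar x\bar y-\bar y\bar x\in\mathbb U^{\deg x+\deg y-1}_{A/k}$. -/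

import Mathlib

open scoped DirectSum

namespace HSEnv

universe u v

/-! ## Co-ideals and truncated power series -/

/-- Multi-indices in `ℕ^p`; `|α|` is `α.degree`, and `≤` is the componentwise order. -/
abbrev MIdx (p : ℕ) := Fin p →₀ ℕ

/-- Non-empty co-ideals of `ℕ^p`: non-empty subsets closed under passing to smaller multi-indices. -/
abbrev Coideal (p : ℕ) := {Δ : LowerSet (MIdx p) // (Δ : Set (MIdx p)).Nonempty}

instance (p : ℕ) : Membership (MIdx p) (Coideal p) := ⟨fun Δ α => α ∈ Δ.1⟩

theorem Coideal.mem_of_le {p : ℕ} {Δ : Coideal p} {α β : MIdx p} (h : α ≤ β) (hβ : β ∈ Δ) :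
    α ∈ Δ := Δ.1.lower h hβ

theorem Coideal.zero_mem {p : ℕ} (Δ : Coideal p) : (0 : MIdx p) ∈ Δ := by
  obtain ⟨α, hα⟩ := Δ.2
  exact Coideal.mem_of_le zero_le hα

/-- The co-ideal `{0}` of `ℕ^p`. -/
def Coideal.zero (p : ℕ) : Coideal p := ⟨LowerSet.Iic 0, ⟨0, LowerSet.mem_Iic_iff.2 le_rfl⟩⟩

theorem fst_le_of_mem {p : ℕ} {α : MIdx p} {b : MIdx p × MIdx p}
    (hb : b ∈ Finset.HasAntidiagonal.antidiagonal α) : b.1 ≤ α :=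
  le_iff_exists_add.2 ⟨b.2, (Finset.HasAntidiagonal.mem_antidiagonal.1 hb).symm⟩

theorem snd_le_of_mem {p : ℕ} {α : MIdx p} {b : MIdx p × MIdx p}
    (hb : b ∈ Finset.HasAntidiagonal.antidiagonal α) : b.2 ≤ α :=
  le_iff_exists_add'.2 ⟨b.1, (Finset.HasAntidiagonal.mem_antidiagonal.1 hb).symm⟩

section TPS

variable {A : Type v} [CommRing A]

/-- The ideal `Δ_A` of `A[[s]]` of the series whose support does not meet `Δ`. -/
def truncIdeal (A : Type v) [CommRing A] {p : ℕ} (Δ : Coideal p) :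
    Ideal (MvPowerSeries (Fin p) A) where
  carrier := {f | ∀ α ∈ Δ, MvPowerSeries.coeff α f = 0}
  zero_mem' := fun α _ => by simp
  add_mem' := fun {f g} hf hg α hα => by simp [hf α hα, hg α hα]
  smul_mem' := fun c f hf α hα => by
    classical
    rw [smul_eq_mul, MvPowerSeries.coeff_mul]
    refine Finset.sum_eq_zero fun x hx => ?_
    rw [hf x.2 (Coideal.mem_of_le (snd_le_of_mem hx) hα), mul_zero]

/-- The truncated power series ring `A[[s]]_Δ = A[[s]] / Δ_A`. -/
abbrev TPS (A : Type v) [CommRing A] {p : ℕ} (Δ : Coideal p) : Type v :=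
  MvPowerSeries (Fin p) A ⧸ truncIdeal A Δ

open Classical in
/-- The coefficient of `s^α` of an element of `A[[s]]_Δ`. For `α ∉ Δ` it is `0`, according to the
embedding of `A[[s]]_Δ` in `A[[s]]` as the set of series with support in `Δ`. -/
noncomputable def TPS.coeff {p : ℕ} {Δ : Coideal p} (α : MIdx p) : TPS A Δ →ₗ[A] A :=
  Submodule.liftQ ((truncIdeal A Δ).restrictScalars A)
    (if α ∈ Δ then MvPowerSeries.coeff (R := A) α else 0) (by
      intro f hf
      by_cases h : α ∈ Δ
      · simpa [h] using hf α h
      · simp [h])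

theorem TPS.coeff_mk {p : ℕ} {Δ : Coideal p} {α : MIdx p} (hα : α ∈ Δ)
    (f : MvPowerSeries (Fin p) A) :
    TPS.coeff α (Ideal.Quotient.mk (truncIdeal A Δ) f) = MvPowerSeries.coeff α f := by
  classical
  have h : TPS.coeff α (Ideal.Quotient.mk (truncIdeal A Δ) f) =
    (if α ∈ Δ then MvPowerSeries.coeff (R := A) α else 0) f := by
    unfold TPS.coeff
    exact (Submodule.liftQ_apply _ _ _).trans (by congr)
  rw [h, if_pos hα]

theorem TPS.coeff_mul {p : ℕ} {Δ : Coideal p} {α : MIdx p} (hα : α ∈ Δ) (x y : TPS A Δ) :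
    TPS.coeff α (x * y) =
      ∑ b ∈ Finset.HasAntidiagonal.antidiagonal α, TPS.coeff b.1 x * TPS.coeff b.2 y := by
  classical
  obtain ⟨f, rfl⟩ := Ideal.Quotient.mk_surjective x
  obtain ⟨g, rfl⟩ := Ideal.Quotient.mk_surjective y
  rw [← map_mul, TPS.coeff_mk hα, MvPowerSeries.coeff_mul]
  refine Finset.sum_congr rfl fun b hb => ?_
  rw [TPS.coeff_mk (Coideal.mem_of_le (fst_le_of_mem hb) hα),
    TPS.coeff_mk (Coideal.mem_of_le (snd_le_of_mem hb) hα)]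

/-- Substitution maps `A[[s]]_Δ → A[[t]]_∇`: the `A`-algebra maps `φ` such that every `φ(s_i)` has
order at least `1`, i.e. has no term of degree `0`. -/
structure SubstMap (A : Type v) [CommRing A] {p q : ℕ} (Δ : Coideal p) (N : Coideal q) where
  toAlgHom : TPS A Δ →ₐ[A] TPS A N
  one_le_ord : ∀ i : Fin p,
    TPS.coeff 0 (toAlgHom (Ideal.Quotient.mk (truncIdeal A Δ) (MvPowerSeries.X i))) = 0

/-- `C_e(φ, α)`: the coefficient of `t^e` in `φ(s^α)`. -/
noncomputable def SubstMap.C {p q : ℕ} {Δ : Coideal p} {N : Coideal q} (φ : SubstMap A Δ N)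
    (e : MIdx q) (α : MIdx p) : A :=
  TPS.coeff e (φ.toAlgHom (Ideal.Quotient.mk (truncIdeal A Δ) (MvPowerSeries.monomial α 1)))

open Classical in
/-- The finite set of the `α ∈ Δ` with `|α| ≤ n`. -/
noncomputable def Coideal.upTo {p : ℕ} (Δ : Coideal p) (n : ℕ) : Finset (MIdx p) :=
  (Finsupp.finite_of_degree_le (σ := Fin p) n).toFinset.filter (fun α => α ∈ Δ)

theorem Coideal.mem_upTo {p : ℕ} {Δ : Coideal p} {n : ℕ} {α : MIdx p} :
    α ∈ Δ.upTo n ↔ α ∈ Δ ∧ α.degree ≤ n := by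
  simp [Coideal.upTo, and_comm]

theorem exists_eq_sum_X_mul {p m : ℕ} (f : MvPowerSeries (Fin p) A)
    (hf : ∀ α : MIdx p, α.degree < m + 1 → MvPowerSeries.coeff α f = 0) :
    ∃ g : Fin p → MvPowerSeries (Fin p) A, f = ∑ i, MvPowerSeries.X i * g i ∧
      ∀ i, ∀ α : MIdx p, α.degree < m → MvPowerSeries.coeff α (g i) = 0 := by
  classical
  let P : MIdx p → Fin p → Prop := fun α i => α i ≠ 0 ∧ ∀ j < i, α j = 0
  have huniq : ∀ α i j, P α i → P α j → i = j := by
    intro α i j hi hj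
    rcases lt_trichotomy i j with h | h | h
    · exact absurd (hj.2 i h) hi.1
    · exact h
    · exact absurd (hi.2 j h) hj.1
  have hex : ∀ α : MIdx p, α ≠ 0 → ∃ i, P α i := by
    intro α hα
    have hne : (Finset.univ.filter fun i => α i ≠ 0).Nonempty := by
      obtain ⟨i, hi⟩ := Finsupp.ne_iff.1 hα
      exact ⟨i, by simpa using hi⟩
    refine ⟨(Finset.univ.filter fun i => α i ≠ 0).min' hne, ?_, ?_⟩
    · simpa using Finset.min'_mem _ hne
    · intro j hj
      by_contra h
      exact absurd (Finset.min'_le _ j (by simpa using h)) (not_le.2 hj)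
  refine ⟨fun i => fun α => if P (α + Finsupp.single i 1) i then
      MvPowerSeries.coeff (α + Finsupp.single i 1) f else 0, ?_, ?_⟩
  · ext α
    have hterm : ∀ i : Fin p, MvPowerSeries.coeff α ((MvPowerSeries.X i :
        MvPowerSeries (Fin p) A) * (show MvPowerSeries (Fin p) A from
          fun α => if P (α + Finsupp.single i 1) i then
            MvPowerSeries.coeff (α + Finsupp.single i 1) f else 0)) =
        if P α i then MvPowerSeries.coeff α f else 0 := by
      intro i
      rw [MvPowerSeries.X_def, MvPowerSeries.coeff_monomial_mul]
      by_cases h : Finsupp.single i 1 ≤ α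
      · rw [if_pos h, one_mul]
        change (if P (α - Finsupp.single i 1 + Finsupp.single i 1) i then
          MvPowerSeries.coeff (α - Finsupp.single i 1 + Finsupp.single i 1) f else 0) = _
        rw [tsub_add_cancel_of_le h]
      · rw [if_neg h, if_neg]
        intro hP
        apply h
        rw [Finsupp.single_le_iff]
        exact Nat.one_le_iff_ne_zero.2 hP.1
    rw [map_sum, Finset.sum_congr rfl fun i _ => hterm i]
    by_cases hα : α = 0
    · subst hα
      rw [hf 0 (by simp)]
      simp
    · obtain ⟨i, hi⟩ := hex α hα
      rw [Finset.sum_eq_single i]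
      · rw [if_pos hi]
      · intro j _ hj
        rw [if_neg fun h => hj (huniq α j i h hi)]
      · simp
  · intro i α hα
    change (if P (α + Finsupp.single i 1) i then
          MvPowerSeries.coeff (α + Finsupp.single i 1) f else 0) = 0
    rw [hf, ite_self]
    rw [map_add, Finsupp.degree_single]
    omega

theorem SubstMap.coeff_eq_zero {p q : ℕ} {Δ : Coideal p} {N : Coideal q} (φ : SubstMap A Δ N)
    (m : ℕ) (f : MvPowerSeries (Fin p) A)
    (hf : ∀ α : MIdx p, α.degree < m → MvPowerSeries.coeff α f = 0)
    (e : MIdx q) (he : e ∈ N) (hem : e.degree < m) :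
    TPS.coeff e (φ.toAlgHom (Ideal.Quotient.mk (truncIdeal A Δ) f)) = 0 := by
  induction m generalizing f e with
  | zero => omega
  | succ m ih =>
    obtain ⟨g, rfl, hg⟩ := exists_eq_sum_X_mul f hf
    rw [map_sum, map_sum, map_sum]
    refine Finset.sum_eq_zero fun i _ => ?_
    rw [map_mul, map_mul, TPS.coeff_mul he]
    refine Finset.sum_eq_zero fun b hb => ?_
    by_cases hb1 : b.1 = 0
    · rw [hb1, φ.one_le_ord, zero_mul]
    · rw [ih (g i) (hg i) b.2 (Coideal.mem_of_le (snd_le_of_mem hb) he), mul_zero]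
      have h1 : b.1.degree + b.2.degree = e.degree := by
        rw [← map_add, Finset.HasAntidiagonal.mem_antidiagonal.1 hb]
      have h2 : b.1.degree ≠ 0 := fun h => hb1 ((Finsupp.degree_eq_zero_iff _).1 h)
      omega

/-- The expansion of `φ(∑ a_α s^α)` through the `C_e(φ, α)`. -/
theorem SubstMap.coeff_apply {p q : ℕ} {Δ : Coideal p} {N : Coideal q} (φ : SubstMap A Δ N)
    (f : MvPowerSeries (Fin p) A) (e : MIdx q) (he : e ∈ N) :
    TPS.coeff e (φ.toAlgHom (Ideal.Quotient.mk (truncIdeal A Δ) f)) =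
      ∑ α ∈ Δ.upTo e.degree, φ.C e α * MvPowerSeries.coeff α f := by
  classical
  let g : MvPowerSeries (Fin p) A := fun α => if α ∈ Δ then MvPowerSeries.coeff α f else 0
  have hgc : ∀ α, MvPowerSeries.coeff α g =
    if α ∈ Δ then MvPowerSeries.coeff α f else 0 := fun α => rfl
  have hg : Ideal.Quotient.mk (truncIdeal A Δ) f = Ideal.Quotient.mk (truncIdeal A Δ) g := by
    rw [Ideal.Quotient.mk_eq_mk_iff_sub_mem]
    intro α hα
    rw [map_sub, hgc, if_pos hα, sub_self]
  let h : MvPowerSeries (Fin p) A :=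
    ∑ α ∈ Δ.upTo e.degree, MvPowerSeries.coeff α f • MvPowerSeries.monomial α (1 : A)
  have hh : TPS.coeff e (φ.toAlgHom (Ideal.Quotient.mk (truncIdeal A Δ) h)) =
      ∑ α ∈ Δ.upTo e.degree, φ.C e α * MvPowerSeries.coeff α f := by
    simp only [h, map_sum]
    refine Finset.sum_congr rfl fun α _ => ?_
    have h1 : Ideal.Quotient.mk (truncIdeal A Δ)
        (MvPowerSeries.coeff α f • MvPowerSeries.monomial α (1 : A)) =
        MvPowerSeries.coeff α f • Ideal.Quotient.mk (truncIdeal A Δ)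
          (MvPowerSeries.monomial α (1 : A)) := rfl
    rw [h1, map_smul, map_smul, SubstMap.C, mul_comm, smul_eq_mul]
  have hd : TPS.coeff e (φ.toAlgHom (Ideal.Quotient.mk (truncIdeal A Δ) (g - h))) = 0 := by
    refine φ.coeff_eq_zero (e.degree + 1) _ ?_ e he (Nat.lt_succ_self _)
    intro α hα
    rw [map_sub, hgc, sub_eq_zero]
    simp only [h, map_sum, map_smul, MvPowerSeries.coeff_monomial, smul_eq_mul, mul_ite, mul_one,
      mul_zero, Finset.sum_ite_eq, Coideal.mem_upTo]
    have : α.degree ≤ e.degree := Nat.lt_succ_iff.1 hα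
    simp [this]
  rw [map_sub, map_sub, map_sub, sub_eq_zero] at hd
  rw [hg, hd, hh]

theorem SubstMap.C_zero_zero {p q : ℕ} {Δ : Coideal p} {N : Coideal q} (φ : SubstMap A Δ N) :
    φ.C 0 0 = 1 := by
  have h1 : (MvPowerSeries.monomial (0 : MIdx p) (1 : A)) = 1 := rfl
  rw [SubstMap.C, h1, map_one, map_one,
    ← map_one (Ideal.Quotient.mk (truncIdeal A N)), TPS.coeff_mk N.zero_mem,
    MvPowerSeries.coeff_zero_one]

end TPS

/-! ## Hasse-Schmidt derivations -/

section HS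

variable {k : Type u} {A : Type v} [CommRing k] [CommRing A] [Algebra k A]

/-- `(p, Δ)`-variate Hasse-Schmidt derivations of `A` over `k`. A family indexed by `Δ` is written
as a family indexed by `ℕ^p` that vanishes outside `Δ`. -/
@[ext]
structure HSDer (k : Type u) (A : Type v) [CommRing k] [CommRing A] [Algebra k A] {p : ℕ}
    (Δ : Coideal p) where
  toFun : MIdx p → A →ₗ[k] A
  map_zero : toFun 0 = LinearMap.id
  leibniz : ∀ α ∈ Δ, ∀ x y : A, toFun α (x * y) =
    ∑ b ∈ Finset.HasAntidiagonal.antidiagonal α, toFun b.1 x * toFun b.2 y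
  eq_zero_of_notMem : ∀ α, α ∉ Δ → toFun α = 0

namespace HSDer

variable {p : ℕ} {Δ : Coideal p}

instance : CoeFun (HSDer k A Δ) (fun _ => MIdx p → A →ₗ[k] A) := ⟨HSDer.toFun⟩

/-- The series `Φ_D(a) = ∑ D_α(a) s^α`. -/
def series (D : HSDer k A Δ) (a : A) : MvPowerSeries (Fin p) A := fun α => D α a

theorem coeff_series (D : HSDer k A Δ) (a : A) (α : MIdx p) :
    MvPowerSeries.coeff α (D.series a) = D α a := rfl

theorem mk_series_mul (D : HSDer k A Δ) (x y : A) :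
    Ideal.Quotient.mk (truncIdeal A Δ) (D.series (x * y)) =
      Ideal.Quotient.mk (truncIdeal A Δ) (D.series x) *
        Ideal.Quotient.mk (truncIdeal A Δ) (D.series y) := by
  classical
  rw [← map_mul, Ideal.Quotient.mk_eq_mk_iff_sub_mem]
  intro α hα
  rw [map_sub, MvPowerSeries.coeff_mul, coeff_series, D.leibniz α hα, sub_eq_zero]
  rfl

open Classical in
/-- The identity Hasse-Schmidt derivation `𝕀`. -/
noncomputable instance : One (HSDer k A Δ) where
  one :=
    { toFun := fun α => if α = 0 then LinearMap.id else 0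
      map_zero := if_pos rfl
      leibniz := by
        intro α _ x y
        by_cases h : α = 0
        · subst h
          simp
        · rw [if_neg h]
          refine (Finset.sum_eq_zero fun b hb => ?_).symm
          have hb' := Finset.HasAntidiagonal.mem_antidiagonal.1 hb
          by_cases h1 : b.1 = 0
          · have h2 : b.2 ≠ 0 := by
              intro h2
              rw [h1, h2, add_zero] at hb'
              exact h hb'.symm
            simp [h2]
          · simp [h1]
      eq_zero_of_notMem := by
        intro α hα
        rw [if_neg]
        rintro rfl
        exact hα Δ.zero_mem }

open Classical in
/-- The composition `(D ∘ E)_α = ∑_{β+γ=α} D_β ∘ E_γ`, the product of the group of `(p, Δ)`-variate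
Hasse-Schmidt derivations. -/
noncomputable instance : Mul (HSDer k A Δ) where
  mul D E :=
    { toFun := fun α => if α ∈ Δ then ∑ b ∈ Finset.HasAntidiagonal.antidiagonal α, D b.1 ∘ₗ E b.2 else 0
      map_zero := by
        rw [if_pos Δ.zero_mem]
        simp [D.map_zero, E.map_zero]
      leibniz := by
        intro α hα x y
        rw [if_pos hα]
        have key : ∀ b ∈ Finset.HasAntidiagonal.antidiagonal α,
            ((if b.1 ∈ Δ then ∑ c ∈ Finset.HasAntidiagonal.antidiagonal b.1, D c.1 ∘ₗ E c.2 else 0) x *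
              (if b.2 ∈ Δ then ∑ c ∈ Finset.HasAntidiagonal.antidiagonal b.2, D c.1 ∘ₗ E c.2 else 0) y) =
            ∑ c ∈ Finset.HasAntidiagonal.antidiagonal b.1, ∑ d ∈ Finset.HasAntidiagonal.antidiagonal b.2,
              D c.1 (E c.2 x) * D d.1 (E d.2 y) := by
          intro b hb
          rw [if_pos (Coideal.mem_of_le (fst_le_of_mem hb) hα),
            if_pos (Coideal.mem_of_le (snd_le_of_mem hb) hα),
            LinearMap.sum_apply, LinearMap.sum_apply, Finset.sum_mul_sum]
          rfl
        rw [Finset.sum_congr rfl key, LinearMap.sum_apply]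
        have key2 : ∀ b ∈ Finset.HasAntidiagonal.antidiagonal α, (D b.1 ∘ₗ E b.2) (x * y) =
            ∑ c ∈ Finset.HasAntidiagonal.antidiagonal b.1, ∑ d ∈ Finset.HasAntidiagonal.antidiagonal b.2,
              D c.1 (E d.1 x) * D c.2 (E d.2 y) := by
          intro b hb
          rw [LinearMap.comp_apply,
            E.leibniz b.2 (Coideal.mem_of_le (snd_le_of_mem hb) hα), map_sum,
            Finset.sum_comm]
          refine Finset.sum_congr rfl fun d _ => ?_
          rw [D.leibniz b.1 (Coideal.mem_of_le (fst_le_of_mem hb) hα)]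
        rw [Finset.sum_congr rfl key2]
        simp only [← Finset.sum_product']
        rw [Finset.sum_sigma', Finset.sum_sigma']
        refine Finset.sum_nbij'
          (fun z => ⟨(z.2.1.1 + z.2.2.1, z.2.1.2 + z.2.2.2),
            ((z.2.1.1, z.2.2.1), (z.2.1.2, z.2.2.2))⟩)
          (fun z => ⟨(z.2.1.1 + z.2.2.1, z.2.1.2 + z.2.2.2),
            ((z.2.1.1, z.2.2.1), (z.2.1.2, z.2.2.2))⟩) ?_ ?_ ?_ ?_ ?_
        · rintro ⟨⟨a, b⟩, ⟨⟨c, d⟩, ⟨e, f⟩⟩⟩ hz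
          simp only [Finset.mem_sigma, Finset.mem_product, Finset.HasAntidiagonal.mem_antidiagonal] at hz ⊢
          obtain ⟨h1, h2, h3⟩ := hz
          refine ⟨?_, trivial, trivial⟩
          rw [← h1, ← h2, ← h3]
          abel
        · rintro ⟨⟨a, b⟩, ⟨⟨c, d⟩, ⟨e, f⟩⟩⟩ hz
          simp only [Finset.mem_sigma, Finset.mem_product, Finset.HasAntidiagonal.mem_antidiagonal] at hz ⊢
          obtain ⟨h1, h2, h3⟩ := hz
          refine ⟨?_, trivial, trivial⟩
          rw [← h1, ← h2, ← h3]
          abel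
        · rintro ⟨⟨a, b⟩, ⟨⟨c, d⟩, ⟨e, f⟩⟩⟩ hz
          simp only [Finset.mem_sigma, Finset.mem_product, Finset.HasAntidiagonal.mem_antidiagonal] at hz ⊢
          obtain ⟨h1, h2, h3⟩ := hz
          subst h2 h3
          rfl
        · rintro ⟨⟨a, b⟩, ⟨⟨c, d⟩, ⟨e, f⟩⟩⟩ hz
          simp only [Finset.mem_sigma, Finset.mem_product, Finset.HasAntidiagonal.mem_antidiagonal] at hz ⊢
          obtain ⟨h1, h2, h3⟩ := hz
          subst h2 h3
          rfl
        · rintro ⟨⟨a, b⟩, ⟨⟨c, d⟩, ⟨e, f⟩⟩⟩ hz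
          rfl
      eq_zero_of_notMem := fun α hα => if_neg hα }

open Classical in
/-- The action `φ • D` of a substitution map:
`(φ • D)_e = ∑_{α ∈ Δ, |α| ≤ |e|} C_e(φ, α) D_α` for `e ∈ ∇`. -/
noncomputable def bullet {q : ℕ} {N : Coideal q} (φ : SubstMap A Δ N) (D : HSDer k A Δ) :
    HSDer k A N where
  toFun := fun e => if e ∈ N then ∑ α ∈ Δ.upTo e.degree, φ.C e α • D α else 0
  map_zero := by
    rw [if_pos N.zero_mem]
    have : Δ.upTo (0 : MIdx q).degree = {0} := by
      ext α
      rw [Coideal.mem_upTo, Finset.mem_singleton, _root_.map_zero, Nat.le_zero,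
        Finsupp.degree_eq_zero_iff]
      exact ⟨fun h => h.2, fun h => ⟨h ▸ Δ.zero_mem, h⟩⟩
    rw [this, Finset.sum_singleton, φ.C_zero_zero, D.map_zero, one_smul]
  leibniz := by
    have key : ∀ e ∈ N, ∀ x : A,
        (if e ∈ N then ∑ α ∈ Δ.upTo e.degree, φ.C e α • D α else 0 : A →ₗ[k] A) x =
          TPS.coeff e (φ.toAlgHom (Ideal.Quotient.mk (truncIdeal A Δ) (D.series x))) := by
      intro e he x
      rw [if_pos he, φ.coeff_apply _ e he, LinearMap.sum_apply]
      rfl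
    intro e he x y
    rw [key e he, mk_series_mul, map_mul, TPS.coeff_mul he]
    refine Finset.sum_congr rfl fun b hb => ?_
    rw [key b.1 (Coideal.mem_of_le (fst_le_of_mem hb) he),
      key b.2 (Coideal.mem_of_le (snd_le_of_mem hb) he)]
  eq_zero_of_notMem := fun e he => if_neg he

/-- `ℓ_α(D)`: the minimum of the `|β|` with `β ≤ α`, `|β| ≥ 1` and `D_β ≠ 0`, and `∞` if there is
no such `β`. -/
noncomputable def ell (D : HSDer k A Δ) (α : MIdx p) : ℕ∞ :=
  ⨅ (β : MIdx p) (_ : β ≤ α ∧ 1 ≤ β.degree ∧ D β ≠ 0), (β.degree : ℕ∞)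

end HSDer

/-! ## The enveloping algebra -/

/-- The variables `S_a` and `T_{p,Δ,D,α}`. -/
inductive Gen (k : Type u) (A : Type v) [CommRing k] [CommRing A] [Algebra k A] : Type v
  | S (a : A) : Gen k A
  | T (p : ℕ) (Δ : Coideal p) (D : HSDer k A Δ) (α : MIdx p) (hα : α ∈ Δ) : Gen k A

/-- `deg S_a = 0` and `deg T_{p,Δ,D,α} = ⌊|α| / ℓ_α(D)⌋`, which is `0` when `ℓ_α(D) = ∞`. -/
noncomputable def Gen.deg : Gen k A → ℕ
  | .S _ => 0
  | .T _ _ D α _ => if D.ell α = ⊤ then 0 else α.degree / (D.ell α).toNat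

/-- The variable `S_a` in the free algebra. -/
def varS (k : Type u) {A : Type v} [CommRing k] [CommRing A] [Algebra k A] (a : A) :
    FreeAlgebra k (Gen k A) := FreeAlgebra.ι k (Gen.S a)

open Classical in
/-- The variable `T_{p,Δ,D,α}` in the free algebra, for `α ∈ Δ` (the value for `α ∉ Δ` is
irrelevant). -/
noncomputable def varT {p : ℕ} {Δ : Coideal p} (D : HSDer k A Δ) (α : MIdx p) :
    FreeAlgebra k (Gen k A) :=
  if hα : α ∈ Δ then FreeAlgebra.ι k (Gen.T p Δ D α hα) else 0

/-- The generators of the two-sided ideal of relations, as pairs `(x, y)` for the generator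
`x - y`. -/
inductive Rel (k : Type u) (A : Type v) [CommRing k] [CommRing A] [Algebra k A] :
    FreeAlgebra k (Gen k A) → FreeAlgebra k (Gen k A) → Prop
  | S_scalar (c : k) : Rel k A (varS k (algebraMap k A c)) (algebraMap k _ c)
  | S_add (a a' : A) : Rel k A (varS k (a + a')) (varS k a + varS k a')
  | S_mul (a a' : A) : Rel k A (varS k (a * a')) (varS k a * varS k a')
  | T_zero (p : ℕ) : Rel k A (varT (1 : HSDer k A (Coideal.zero p)) 0) 1
  | T_one (p : ℕ) (Δ : Coideal p) (α : MIdx p) (hα : α ∈ Δ) (h : 0 < α.degree) :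
      Rel k A (varT (1 : HSDer k A Δ) α) 0
  | T_comp (p : ℕ) (Δ : Coideal p) (D E : HSDer k A Δ) (α : MIdx p) (hα : α ∈ Δ) :
      Rel k A (varT (D * E) α) (∑ b ∈ Finset.HasAntidiagonal.antidiagonal α, varT D b.1 * varT E b.2)
  | T_S (p : ℕ) (Δ : Coideal p) (D : HSDer k A Δ) (α : MIdx p) (hα : α ∈ Δ) (a : A) :
      Rel k A (varT D α * varS k a)
        (∑ b ∈ Finset.HasAntidiagonal.antidiagonal α, varS k (D b.1 a) * varT D b.2)
  | T_subst (p q : ℕ) (Δ : Coideal p) (N : Coideal q) (φ : SubstMap A Δ N) (D : HSDer k A Δ)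
      (β : MIdx q) (hβ : β ∈ N) :
      Rel k A (varT (HSDer.bullet φ D) β)
        (∑ α ∈ Δ.upTo β.degree, varS k (φ.C β α) * varT D α)

/-- The enveloping algebra `𝕌_{A/k}` of the Hasse-Schmidt derivations of `A` over `k`: the quotient
of the free `k`-algebra on the variables by the two-sided ideal generated by the relations. -/
def UAlg (k : Type u) (A : Type v) [CommRing k] [CommRing A] [Algebra k A] : Type (max u v) :=
  RingQuot (Rel k A)

noncomputable instance : Ring (UAlg k A) := inferInstanceAs (Ring (RingQuot (Rel k A)))

noncomputable instance : Algebra k (UAlg k A) := inferInstanceAs (Algebra k (RingQuot (Rel k A)))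

/-- The quotient map from the free algebra to `𝕌_{A/k}`. -/
noncomputable def toU (k : Type u) (A : Type v) [CommRing k] [CommRing A] [Algebra k A] :
    FreeAlgebra k (Gen k A) →ₐ[k] UAlg k A := RingQuot.mkAlgHom k (Rel k A)

/-- The homogeneous component of degree `d` of the free algebra, for the grading in which every
variable `x` has degree `x.deg`: the span of the monomials of total degree `d`. -/
def freeHomog (k : Type u) (A : Type v) [CommRing k] [CommRing A] [Algebra k A] (d : ℕ) :
    Submodule k (FreeAlgebra k (Gen k A)) :=
  Submodule.span k {m | ∃ l : List (Gen k A), (l.map Gen.deg).sum = d ∧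
    (l.map (FreeAlgebra.ι k)).prod = m}

/-- `𝕌^d`: the image of the sum of the homogeneous components of degree at most `d`. -/
noncomputable def filU (k : Type u) (A : Type v) [CommRing k] [CommRing A] [Algebra k A] (d : ℕ) :
    Submodule k (UAlg k A) :=
  (⨆ (e : ℕ) (_ : e ≤ d), freeHomog k A e).map (toU k A).toLinearMap

/-- The elements of `𝕌_{A/k}` of degree strictly less than `d`: `𝕌^{d-1}` for `d ≥ 1`, and `0` for
`d = 0`. -/
noncomputable def filLtU (k : Type u) (A : Type v) [CommRing k] [CommRing A] [Algebra k A]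
    (d : ℕ) : Submodule k (UAlg k A) :=
  ⨆ (e : ℕ) (_ : e < d), filU k A e

theorem filU_eq_span (d : ℕ) : filU k A d = Submodule.span k {m | ∃ l : List (Gen k A),
    (l.map Gen.deg).sum ≤ d ∧ (l.map fun x => toU k A (FreeAlgebra.ι k x)).prod = m} := by
  rw [filU]
  simp only [freeHomog, Submodule.map_span, ← Submodule.span_iUnion]
  congr 1
  ext m
  simp only [Set.mem_iUnion, Set.mem_image, Set.mem_ofPred_eq, AlgHom.toLinearMap_apply]
  constructor
  · rintro ⟨_, ⟨e, he, l, hl, rfl⟩, rfl⟩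
    exact ⟨l, hl.trans_le he, by rw [map_list_prod, List.map_map]; rfl⟩
  · rintro ⟨l, hl, rfl⟩
    exact ⟨_, ⟨_, hl, l, rfl, rfl⟩, by rw [map_list_prod, List.map_map]; rfl⟩

instance isRingFiltration_filU : IsRingFiltration (filU k A) (filLtU k A) where
  mono := by
    intro d e h
    rw [filU_eq_span, filU_eq_span]
    refine Submodule.span_mono ?_
    rintro _ ⟨l, hl, rfl⟩
    exact ⟨l, hl.trans h, rfl⟩
  is_le := fun {i j} h => le_iSup₂_of_le i h le_rfl
  is_sup := fun B j h => iSup₂_le h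
  one_mem := by
    rw [filU_eq_span]
    exact Submodule.subset_span ⟨[], by simp, by simp⟩
  mul_mem := by
    intro i j x y hx hy
    rw [filU_eq_span] at hx hy ⊢
    have h := Submodule.mul_mem_mul hx hy
    rw [Submodule.span_mul_span] at h
    refine Submodule.span_mono ?_ h
    rintro _ ⟨_, ⟨l, hl, rfl⟩, _, ⟨l', hl', rfl⟩, rfl⟩
    exact ⟨l ++ l', by simpa using add_le_add hl hl', by simp⟩

end HS

/-! ## The associated graded ring of a filtered ring -/

section Gr

variable {k : Type u} {R : Type v} [CommRing k] [Ring R] [Algebra k R]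
  (F Flt : ℕ → Submodule k R)

/-- The component `F_d / F_{<d}` of degree `d` of the associated graded ring. -/
def GrPiece (d : ℕ) : Type v := (F d) ⧸ ((Flt d).comap (F d).subtype)

instance (d : ℕ) : AddCommGroup (GrPiece F Flt d) :=
  inferInstanceAs (AddCommGroup ((F d) ⧸ ((Flt d).comap (F d).subtype)))

instance (d : ℕ) : Module k (GrPiece F Flt d) :=
  inferInstanceAs (Module k ((F d) ⧸ ((Flt d).comap (F d).subtype)))

/-- The class of `x ∈ F_d` in `F_d / F_{<d}`. -/
def GrPiece.mk (d : ℕ) : F d →ₗ[k] GrPiece F Flt d :=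
  ((Flt d).comap (F d).subtype).mkQ

theorem GrPiece.mk_surjective (d : ℕ) : Function.Surjective (GrPiece.mk F Flt d) :=
  Submodule.mkQ_surjective _

theorem GrPiece.mk_eq_zero {d : ℕ} (x : F d) : GrPiece.mk F Flt d x = 0 ↔ (x : R) ∈ Flt d :=
  Submodule.Quotient.mk_eq_zero _

theorem GrPiece.mk_eq_of {i j : ℕ} (h : i = j) (x : F i) (y : F j) (hxy : (x : R) = y) :
    GradedMonoid.mk (A := GrPiece F Flt) i (GrPiece.mk F Flt i x) =
      GradedMonoid.mk j (GrPiece.mk F Flt j y) := by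
  subst h
  rw [Subtype.ext hxy]

variable [IsRingFiltration F Flt]

variable {F Flt} in
theorem lt_mul_mem {i j : ℕ} {x y : R} (hx : x ∈ Flt i) (hy : y ∈ F j) :
    x * y ∈ Flt (i + j) := by
  have : Flt i ≤ (Flt (i + j)).comap (LinearMap.mulRight k y) :=
    IsFiltration.is_sup (F := F) _ i fun i' hi' z hz =>
      IsFiltration.is_le (F := F) (Nat.add_lt_add_right hi' j)
        (SetLike.GradedMul.mul_mem (A := F) hz hy)
  exact this hx

variable {F Flt} in
theorem mul_lt_mem {i j : ℕ} {x y : R} (hx : x ∈ F i) (hy : y ∈ Flt j) :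
    x * y ∈ Flt (i + j) := by
  have : Flt j ≤ (Flt (i + j)).comap (LinearMap.mulLeft k x) :=
    IsFiltration.is_sup (F := F) _ j fun j' hj' z hz =>
      IsFiltration.is_le (F := F) (Nat.add_lt_add_left hj' i)
        (SetLike.GradedMul.mul_mem (A := F) hx hz)
  exact this hy

/-- The product `F_i / F_{<i} × F_j / F_{<j} → F_{i+j} / F_{<i+j}` induced by that of the ring. -/
def GrPiece.mul {i j : ℕ} (x : GrPiece F Flt i) (y : GrPiece F Flt j) : GrPiece F Flt (i + j) :=
  Quotient.map₂
    (fun (a : F i) (b : F j) => (⟨a * b, SetLike.GradedMul.mul_mem a.2 b.2⟩ : F (i + j)))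
    (by
      intro a a' ha b b' hb
      have ha' : (a : R) - a' ∈ Flt i := (Submodule.quotientRel_def ((Flt i).comap (F i).subtype)).1 ha
      have hb' : (b : R) - b' ∈ Flt j := (Submodule.quotientRel_def ((Flt j).comap (F j).subtype)).1 hb
      refine (Submodule.quotientRel_def _).2 ?_
      change (a : R) * b - a' * b' ∈ Flt (i + j)
      have : (a : R) * b - a' * b' = (a - a') * b + a' * (b - b') := by noncomm_ring
      rw [this]
      exact add_mem (lt_mul_mem (F := F) ha' b.2) (mul_lt_mem a'.2 hb')) x y

theorem GrPiece.mul_mk {i j : ℕ} (a : F i) (b : F j) :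
    GrPiece.mul F Flt (GrPiece.mk F Flt i a) (GrPiece.mk F Flt j b) =
      GrPiece.mk F Flt (i + j) ⟨a * b, SetLike.GradedMul.mul_mem a.2 b.2⟩ := rfl

instance grPieceGOne : GradedMonoid.GOne (GrPiece F Flt) where
  one := GrPiece.mk F Flt 0 ⟨1, SetLike.GradedOne.one_mem⟩

instance grPieceGMul : GradedMonoid.GMul (GrPiece F Flt) where
  mul := GrPiece.mul F Flt

instance grPieceGRing : DirectSum.GRing (GrPiece F Flt) where
  mul_zero := by
    intro i j a
    obtain ⟨a, rfl⟩ := GrPiece.mk_surjective F Flt _ a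
    refine (congrArg (GrPiece.mul F Flt _) (map_zero (GrPiece.mk F Flt j)).symm).trans ?_
    rw [GrPiece.mul_mk, GrPiece.mk_eq_zero]
    simp
  zero_mul := by
    intro i j b
    obtain ⟨b, rfl⟩ := GrPiece.mk_surjective F Flt _ b
    refine (congrArg (fun z => GrPiece.mul F Flt z _) (map_zero (GrPiece.mk F Flt i)).symm).trans ?_
    rw [GrPiece.mul_mk, GrPiece.mk_eq_zero]
    simp
  mul_add := by
    intro i j a b c
    obtain ⟨a, rfl⟩ := GrPiece.mk_surjective F Flt _ a
    obtain ⟨b, rfl⟩ := GrPiece.mk_surjective F Flt _ b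
    obtain ⟨c, rfl⟩ := GrPiece.mk_surjective F Flt _ c
    refine congrArg (GrPiece.mk F Flt (i + j)) (Subtype.ext ?_)
    exact _root_.mul_add (a : R) b c
  add_mul := by
    intro i j a b c
    obtain ⟨a, rfl⟩ := GrPiece.mk_surjective F Flt _ a
    obtain ⟨b, rfl⟩ := GrPiece.mk_surjective F Flt _ b
    obtain ⟨c, rfl⟩ := GrPiece.mk_surjective F Flt _ c
    refine congrArg (GrPiece.mk F Flt (i + j)) (Subtype.ext ?_)
    exact _root_.add_mul (a : R) b c
  one_mul := by
    rintro ⟨i, a⟩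
    obtain ⟨a, rfl⟩ := GrPiece.mk_surjective F Flt _ a
    exact GrPiece.mk_eq_of F Flt (zero_add i) _ a (_root_.one_mul (a : R))
  mul_one := by
    rintro ⟨i, a⟩
    obtain ⟨a, rfl⟩ := GrPiece.mk_surjective F Flt _ a
    exact GrPiece.mk_eq_of F Flt (add_zero i) _ a (_root_.mul_one (a : R))
  mul_assoc := by
    rintro ⟨i, a⟩ ⟨j, b⟩ ⟨l, c⟩
    obtain ⟨a, rfl⟩ := GrPiece.mk_surjective F Flt _ a
    obtain ⟨b, rfl⟩ := GrPiece.mk_surjective F Flt _ b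
    obtain ⟨c, rfl⟩ := GrPiece.mk_surjective F Flt _ c
    exact GrPiece.mk_eq_of F Flt (add_assoc i j l) _ _ (_root_.mul_assoc (a : R) b c)
  natCast := fun n => n • GrPiece.mk F Flt 0 ⟨1, SetLike.GradedOne.one_mem⟩
  natCast_zero := zero_smul _ _
  natCast_succ := fun n => succ_nsmul _ n
  intCast := fun n => n • GrPiece.mk F Flt 0 ⟨1, SetLike.GradedOne.one_mem⟩
  intCast_ofNat := fun n => natCast_zsmul _ n
  intCast_negSucc_ofNat := fun n => negSucc_zsmul _ n

/-- The associated graded ring `⨁_d F_d / F_{<d}` of a filtered ring. -/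
abbrev Gr : Type v := ⨁ d, GrPiece F Flt d

end Gr

/-- The graded ring `gr 𝕌_{A/k}`. -/
abbrev GrU (k : Type u) (A : Type v) [CommRing k] [CommRing A] [Algebra k A] : Type (max u v) :=
  Gr (filU k A) (filLtU k A)

end HSEnv

/-!
The commutator of two monomials is a sum of monomials each containing a commutator of two of the
generators, so it is enough to see that the commutator of two generators `x`, `y` has degree less
than `deg x + deg y`.

The classes of the `S_a` commute. By `Rel.T_S`, `[T_{D,α}, S_a]` is the sum of the
`S_{D_β(a)} T_{D,α-β}` with `0 ≠ β ≤ α`; it involves only `β` with `|β| ≥ ℓ_α(D)`, and subtracting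
such a `β` lowers `⌊|α| / ℓ_α(D)⌋` (`commutator_uT_uS_mem`).

For two variables `T_{D,α}` and `T_{E,β}`, substitution along the inclusions of the first and of
the last variables makes `D` and `E` into Hasse-Schmidt derivations `D'` and `E'` in `p + q`
variables, over the co-ideal of the multi-indices `≤ (α, β)`. By `Rel.T_comp` and `Rel.T_subst`,
`T_{D,α} T_{E,β} = T_{D'E',(α,β)}` and `T_{E,β} T_{D,α} = T_{E'D',(α,β)}`. One can divide
Hasse-Schmidt derivations (`HSDer.exists_mul_eq`), so `D'E' = E'D'F` for some `F`. The components
of `F` vanish at the nonzero `(a, b)` with `|a| < ℓ_α(D)` or `|b| < ℓ_β(E)`, because `D'E'` and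
`E'D'` agree up to `(a, b)`; so do the corresponding `T_{F,(a,b)}`, since the class of a variable
depends only on the components of the derivation up to its multi-index (`uT_congr`). At the other
nonzero multi-indices `deg T_{F,(a,b)} ≤ ⌊(|a| + |b|) / (ℓ_α(D) + ℓ_β(E))⌋`, which is less than
`⌊|a| / ℓ_α(D)⌋ + ⌊|b| / ℓ_β(E)⌋` because both of these are at least `1`. Expanding
`T_{E'D'F,(α,β)}` by `Rel.T_comp` yields the claim (`commutator_uT_uT_mem`). If `ℓ_α(D) = ∞`, the
class of `T_{D,α}` is `0` or `1`.
-/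

namespace HSEnv

open Finset.HasAntidiagonal (antidiagonal mem_antidiagonal)

universe u v

/-! ### Substitution maps induced by injections of the variables -/

section Embedding

variable {A : Type v} [CommRing A] {p r : ℕ} {Δ : Coideal p} {N : Coideal r}

theorem truncIdeal_le_comap_rename (e : Fin p ↪ Fin r)
    (h : ∀ α : MIdx p, α.embDomain e ∈ N → α ∈ Δ) :
    truncIdeal A Δ ≤ (truncIdeal A N).comap (MvPowerSeries.rename (R := A) e) := by
  intro f hf δ hδ
  by_cases hr : δ ∈ Set.range (Finsupp.mapDomain (M := ℕ) e)
  · obtain ⟨α, rfl⟩ := Set.mem_range.1 hr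
    rw [← Finsupp.embDomain_eq_mapDomain] at hδ ⊢
    rw [MvPowerSeries.coeff_embDomain_rename]
    exact hf α (h α hδ)
  · exact MvPowerSeries.coeff_rename_eq_zero _ _ hr

/-- The substitution map `s_i ↦ t_{e i}` for an injection `e` of the variables. It is defined on
the truncated rings as soon as every multi-index of `N` supported on the image of `e` comes from
`Δ`. For `e = id` this is the truncation `A[[s]]_Δ → A[[s]]_N`, `N ⊆ Δ`. -/
noncomputable def SubstMap.ofEmb (e : Fin p ↪ Fin r)
    (h : ∀ α : MIdx p, α.embDomain e ∈ N → α ∈ Δ) : SubstMap A Δ N where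
  toAlgHom := Ideal.quotientMapₐ (truncIdeal A N) (MvPowerSeries.rename (R := A) e)
    (truncIdeal_le_comap_rename e h)
  one_le_ord := fun i => by
    have h1 : Ideal.quotientMapₐ (truncIdeal A N) (MvPowerSeries.rename (R := A) e)
        (truncIdeal_le_comap_rename e h) (Ideal.Quotient.mk _ (MvPowerSeries.X i)) =
        Ideal.Quotient.mk _ (MvPowerSeries.X (e i)) :=
      congrArg (Ideal.Quotient.mk (truncIdeal A N)) (MvPowerSeries.rename_X e i)
    rw [h1, TPS.coeff_mk N.zero_mem, MvPowerSeries.coeff_zero_X]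

theorem SubstMap.ofEmb_C (e : Fin p ↪ Fin r) (h : ∀ α : MIdx p, α.embDomain e ∈ N → α ∈ Δ)
    {δ : MIdx r} (hδ : δ ∈ N) (α : MIdx p) :
    (SubstMap.ofEmb (A := A) e h).C δ α = if δ = α.embDomain e then 1 else 0 := by
  have h1 : (SubstMap.ofEmb (A := A) e h).toAlgHom
      (Ideal.Quotient.mk _ (MvPowerSeries.monomial α 1)) =
      Ideal.Quotient.mk _ (MvPowerSeries.monomial (α.embDomain e) 1) := by
    rw [Finsupp.embDomain_eq_mapDomain]
    exact congrArg (Ideal.Quotient.mk (truncIdeal A N)) (MvPowerSeries.rename_monomial e α 1)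
  rw [SubstMap.C, h1, TPS.coeff_mk hδ, MvPowerSeries.coeff_monomial]

theorem degree_embDomain (e : Fin p ↪ Fin r) (α : MIdx p) :
    (α.embDomain e).degree = α.degree := by
  rw [Finsupp.embDomain_eq_mapDomain, Finsupp.degree_mapDomain]

/-- Substitution along an injection of the variables picks out one coefficient. -/
theorem sum_ofEmb_C {M : Type*} [AddCommMonoid M] (e : Fin p ↪ Fin r)
    (h : ∀ α : MIdx p, α.embDomain e ∈ N → α ∈ Δ) (α : MIdx p) (hα : α.embDomain e ∈ N)
    (f : A → MIdx p → M) (hf : ∀ β, f 0 β = 0) :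
    ∑ β ∈ Δ.upTo (α.embDomain e).degree, f ((SubstMap.ofEmb (A := A) e h).C (α.embDomain e) β) β =
      f 1 α := by
  classical
  rw [Finset.sum_eq_single α]
  · rw [SubstMap.ofEmb_C e h hα, if_pos rfl]
  · intro β _ hβ
    rw [SubstMap.ofEmb_C e h hα, if_neg, hf]
    exact fun hh => hβ (Finsupp.embDomain_injective e hh).symm
  · intro hn
    refine absurd (Coideal.mem_upTo.2 ⟨h α hα, ?_⟩) hn
    rw [degree_embDomain]

theorem sum_ofEmb_C_of_notMem_range {M : Type*} [AddCommMonoid M] (e : Fin p ↪ Fin r)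
    (h : ∀ α : MIdx p, α.embDomain e ∈ N → α ∈ Δ) {δ : MIdx r} (hδ : δ ∈ N)
    (hr : δ ∉ Set.range (Finsupp.embDomain (M := ℕ) e))
    (f : A → MIdx p → M) (hf : ∀ β, f 0 β = 0) :
    ∑ β ∈ Δ.upTo δ.degree, f ((SubstMap.ofEmb (A := A) e h).C δ β) β = 0 := by
  classical
  refine Finset.sum_eq_zero fun β _ => ?_
  rw [SubstMap.ofEmb_C e h hδ, if_neg, hf]
  exact fun hh => hr ⟨β, hh.symm⟩

end Embedding

namespace HSDer

variable {k : Type u} {A : Type v} [CommRing k] [CommRing A] [Algebra k A]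
  {p r : ℕ} {Δ : Coideal p} {N : Coideal r}

theorem bullet_apply (φ : SubstMap A Δ N) (D : HSDer k A Δ) {δ : MIdx r} (hδ : δ ∈ N) :
    bullet φ D δ = ∑ α ∈ Δ.upTo δ.degree, φ.C δ α • D α := if_pos hδ

theorem bullet_ofEmb_embDomain (e : Fin p ↪ Fin r)
    (h : ∀ α : MIdx p, α.embDomain e ∈ N → α ∈ Δ) (D : HSDer k A Δ) {α : MIdx p}
    (hα : α.embDomain e ∈ N) : bullet (SubstMap.ofEmb e h) D (α.embDomain e) = D α := by
  rw [bullet_apply _ _ hα, sum_ofEmb_C e h α hα (fun a β => a • D β) fun β => zero_smul _ _,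
    one_smul]

theorem bullet_ofEmb_of_notMem_range (e : Fin p ↪ Fin r)
    (h : ∀ α : MIdx p, α.embDomain e ∈ N → α ∈ Δ) (D : HSDer k A Δ) {δ : MIdx r}
    (hr : δ ∉ Set.range (Finsupp.embDomain (M := ℕ) e)) :
    bullet (SubstMap.ofEmb e h) D δ = 0 := by
  by_cases hδ : δ ∈ N
  · rw [bullet_apply _ _ hδ,
      sum_ofEmb_C_of_notMem_range e h hδ hr (fun a β => a • D β) fun β => zero_smul _ _]
  · exact (bullet _ D).eq_zero_of_notMem δ hδ

/-! ### Division of Hasse-Schmidt derivations -/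

theorem one_apply_of_ne_zero {α : MIdx p} (hα : α ≠ 0) : (1 : HSDer k A Δ) α = 0 := if_neg hα

theorem mul_apply (D E : HSDer k A Δ) {α : MIdx p} (hα : α ∈ Δ) :
    (D * E) α = ∑ b ∈ antidiagonal α, D b.1 ∘ₗ E b.2 := if_pos hα

theorem sum_antidiagonal_eq_of_lt {M : Type*} [AddCommMonoid M] {α : MIdx p}
    (f : MIdx p × MIdx p → M) (hf : ∀ b ∈ antidiagonal α, b.2 < α → f b = 0) :
    ∑ b ∈ antidiagonal α, f b = f (0, α) := by
  rw [Finset.sum_eq_single (0, α)]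
  · intro b hb hne
    refine hf b hb (lt_of_le_of_ne (snd_le_of_mem hb) fun h2 => hne ?_)
    have h1 := mem_antidiagonal.1 hb
    rw [h2] at h1
    exact Prod.ext (left_eq_add.1 (by rw [add_comm]; exact h1.symm)) h2
  · intro h
    exact absurd (mem_antidiagonal.2 (zero_add α)) h

/-- Regrouping a fourfold sum according to `(a + b) + (c + d) = (a + c) + (b + d)`. -/
theorem sum_antidiagonal_four {M : Type*} [AddCommMonoid M] (α : MIdx p)
    (f : MIdx p → MIdx p → MIdx p → MIdx p → M) :
    ∑ b ∈ antidiagonal α, ∑ c ∈ antidiagonal b.1, ∑ d ∈ antidiagonal b.2, f c.1 c.2 d.1 d.2 =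
      ∑ b ∈ antidiagonal α, ∑ c ∈ antidiagonal b.1, ∑ d ∈ antidiagonal b.2,
        f c.1 d.1 c.2 d.2 := by
  simp only [← Finset.sum_product']
  rw [Finset.sum_sigma', Finset.sum_sigma']
  refine Finset.sum_nbij'
    (fun z => ⟨(z.2.1.1 + z.2.2.1, z.2.1.2 + z.2.2.2), ((z.2.1.1, z.2.2.1), (z.2.1.2, z.2.2.2))⟩)
    (fun z => ⟨(z.2.1.1 + z.2.2.1, z.2.1.2 + z.2.2.2), ((z.2.1.1, z.2.2.1), (z.2.1.2, z.2.2.2))⟩)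
    ?_ ?_ ?_ ?_ (fun _ _ => rfl)
  all_goals
    rintro ⟨⟨a, b⟩, ⟨⟨c, d⟩, ⟨e, f⟩⟩⟩ hz
    simp only [Finset.mem_sigma, Finset.mem_product, mem_antidiagonal] at hz ⊢
    obtain ⟨h1, h2, h3⟩ := hz
    subst h2 h3
    first
      | rfl
      | exact ⟨by rw [← h1]; abel, trivial, trivial⟩

/-- If `E ∘ F` is a Hasse-Schmidt derivation and `E` is one, so is the family `F`: the defect of
the Leibniz rule for `F` at `α` is, by induction on `α`, the defect for `E ∘ F`. -/
theorem leibniz_of_mul (D E : HSDer k A Δ) (F : MIdx p → A →ₗ[k] A)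
    (hF : ∀ α ∈ Δ, ∑ b ∈ antidiagonal α, E b.1 ∘ₗ F b.2 = D α) (α : MIdx p) (hα : α ∈ Δ)
    (x y : A) : F α (x * y) = ∑ b ∈ antidiagonal α, F b.1 x * F b.2 y := by
  classical
  induction α using WellFoundedLT.induction with
  | ind α ih =>
  have hFx : ∀ γ ≤ α, ∀ z : A, D γ z = ∑ b ∈ antidiagonal γ, E b.1 (F b.2 z) := by
    intro γ hγ z
    rw [← hF γ (Coideal.mem_of_le hγ hα), LinearMap.sum_apply]
    rfl
  -- `E` applied to the defect of `F`; the terms with `b.2 < α` vanish by induction.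
  have key : ∑ b ∈ antidiagonal α,
      E b.1 (F b.2 (x * y) - ∑ c ∈ antidiagonal b.2, F c.1 x * F c.2 y) = 0 := by
    simp only [map_sub, map_sum, Finset.sum_sub_distrib]
    rw [← hFx α le_rfl, D.leibniz α hα, sub_eq_zero]
    have h1 : ∀ b ∈ antidiagonal α, D b.1 x * D b.2 y =
        ∑ c ∈ antidiagonal b.1, ∑ d ∈ antidiagonal b.2,
          E c.1 (F c.2 x) * E d.1 (F d.2 y) := by
      intro b hb
      rw [hFx _ (fst_le_of_mem hb), hFx _ (snd_le_of_mem hb), Finset.sum_mul_sum]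
    have h2 : ∀ b ∈ antidiagonal α, ∑ c ∈ antidiagonal b.2, E b.1 (F c.1 x * F c.2 y) =
        ∑ c ∈ antidiagonal b.1, ∑ d ∈ antidiagonal b.2,
          E c.1 (F d.1 x) * E c.2 (F d.2 y) := by
      intro b hb
      rw [Finset.sum_comm]
      exact Finset.sum_congr rfl fun d _ =>
        E.leibniz b.1 (Coideal.mem_of_le (fst_le_of_mem hb) hα) _ _
    rw [Finset.sum_congr rfl h1, Finset.sum_congr rfl h2]
    exact sum_antidiagonal_four α fun a b c d => E a (F b x) * E c (F d y)
  rw [sum_antidiagonal_eq_of_lt, E.map_zero, LinearMap.id_apply, sub_eq_zero] at key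
  · exact key
  · intro b hb hlt
    rw [ih b.2 hlt (Coideal.mem_of_le hlt.le hα), sub_self, _root_.map_zero]

/-- Hasse-Schmidt derivations can be divided: `E ∘ F = D` is solvable in `F`. The family `F` is
computed in the ring of power series over `End_k(A)`, where `E` is invertible. -/
theorem exists_mul_eq (D E : HSDer k A Δ) : ∃ F : HSDer k A Δ, E * F = D := by
  classical
  let sE : MvPowerSeries (Fin p) (Module.End k A) := E.toFun
  let sD : MvPowerSeries (Fin p) (Module.End k A) := D.toFun
  have hsE : MvPowerSeries.constantCoeff sE = ((1 : (Module.End k A)ˣ) : Module.End k A) := by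
    rw [← MvPowerSeries.coeff_zero_eq_constantCoeff_apply]
    exact E.map_zero
  let sF := MvPowerSeries.invOfUnit sE 1 * sD
  have hmul : sE * sF = sD := by
    rw [← mul_assoc, MvPowerSeries.mul_invOfUnit sE 1 hsE, one_mul]
  let F : MIdx p → A →ₗ[k] A := fun α => if α ∈ Δ then MvPowerSeries.coeff α sF else 0
  have hF : ∀ α ∈ Δ, ∑ b ∈ antidiagonal α, E b.1 ∘ₗ F b.2 = D α := by
    intro α hα
    have h1 : MvPowerSeries.coeff α (sE * sF) = D α := by rw [hmul]; rfl
    rw [← h1, MvPowerSeries.coeff_mul]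
    refine Finset.sum_congr rfl fun b hb => ?_
    simp only [F, if_pos (Coideal.mem_of_le (snd_le_of_mem hb) hα)]
    rfl
  refine ⟨⟨F, ?_, leibniz_of_mul D E F hF, fun α hα => if_neg hα⟩, ?_⟩
  · have h0 := hF 0 Δ.zero_mem
    rw [sum_antidiagonal_eq_of_lt _ fun b _ hlt => absurd hlt not_lt_zero, E.map_zero,
      D.map_zero, LinearMap.id_comp] at h0
    exact h0
  · ext1
    funext α
    by_cases hα : α ∈ Δ
    · exact (mul_apply _ _ hα).trans (hF α hα)
    · rw [eq_zero_of_notMem _ α hα, eq_zero_of_notMem _ α hα]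

/-- If `E` and `E ∘ F` agree up to `γ`, then `F` is trivial up to `γ`: in `(E ∘ F)_δ` only the
terms `E_δ` and `F_δ` survive, by induction on `δ`. -/
theorem eq_zero_of_mul_agree {E F : HSDer k A Δ} {γ : MIdx p} (hγ : γ ∈ Δ)
    (h : ∀ δ ≤ γ, (E * F) δ = E δ) {δ : MIdx p} (hδ : δ ≤ γ) (h0 : δ ≠ 0) : F δ = 0 := by
  classical
  induction δ using WellFoundedLT.induction with
  | ind δ ih =>
  have hδΔ := Coideal.mem_of_le hδ hγ
  have h1 := h δ hδ
  rw [mul_apply _ _ hδΔ] at h1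
  have hne : ((0, δ) : MIdx p × MIdx p) ≠ (δ, 0) := fun hh => h0 (Prod.ext_iff.1 hh).2
  rw [Finset.sum_eq_add (0, δ) (δ, 0) hne] at h1
  · rw [F.map_zero, E.map_zero, LinearMap.comp_id, LinearMap.id_comp] at h1
    exact add_eq_right.1 h1
  · rintro ⟨b, c⟩ hb ⟨hb1, hb2⟩
    have hs := mem_antidiagonal.1 hb
    simp only at hs
    have hc0 : c ≠ 0 := by
      rintro rfl
      exact hb2 (by rw [← hs, add_zero])
    have hcδ : c ≠ δ := by
      rintro rfl
      exact hb1 (by rw [add_eq_right.1 hs])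
    have hle : c ≤ δ := snd_le_of_mem hb
    rw [show F c = 0 from ih c (lt_of_le_of_ne hle hcδ) (hle.trans hδ) hc0, LinearMap.comp_zero]
  · intro hn
    exact absurd (mem_antidiagonal.2 (zero_add δ)) hn
  · intro hn
    exact absurd (mem_antidiagonal.2 (add_zero δ)) hn

theorem natCast_le_ell {D : HSDer k A Δ} {α : MIdx p} {n : ℕ} :
    (n : ℕ∞) ≤ D.ell α ↔ ∀ β ≤ α, β ≠ 0 → D β ≠ 0 → n ≤ β.degree := by
  simp only [ell, le_iInf_iff, Nat.cast_le, Nat.one_le_iff_ne_zero, ne_eq,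
    Finsupp.degree_eq_zero_iff, and_imp]

theorem ell_eq_top {D : HSDer k A Δ} {α : MIdx p} :
    D.ell α = ⊤ ↔ ∀ β ≤ α, β ≠ 0 → D β = 0 := by
  simp only [ell, iInf_eq_top, ENat.natCast_ne_top, Nat.one_le_iff_ne_zero, ne_eq,
    Finsupp.degree_eq_zero_iff, imp_false, not_and, not_not]

theorem ell_ne_zero (D : HSDer k A Δ) (α : MIdx p) : D.ell α ≠ 0 := by
  have : ((1 : ℕ) : ℕ∞) ≤ D.ell α := natCast_le_ell.2 fun β _ hβ _ =>
    Nat.one_le_iff_ne_zero.2 fun h => hβ ((Finsupp.degree_eq_zero_iff _).1 h)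
  intro h
  rw [h] at this
  simp at this

end HSDer

section Enveloping

variable {k : Type u} {A : Type v} [CommRing k] [CommRing A] [Algebra k A]
  {p q r : ℕ} {Δ : Coideal p} {N : Coideal r}

/-! ### Relations in the enveloping algebra -/

/-- The class of the variable `S_a` in `𝕌_{A/k}`. -/
noncomputable def uS (k : Type u) {A : Type v} [CommRing k] [CommRing A] [Algebra k A] (a : A) :
    UAlg k A := toU k A (varS k a)

/-- The class of the variable `T_{p,Δ,D,α}` in `𝕌_{A/k}`, and `0` for `α ∉ Δ`. -/
noncomputable def uT (D : HSDer k A Δ) (α : MIdx p) : UAlg k A := toU k A (varT D α)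

theorem toU_rel {x y : FreeAlgebra k (Gen k A)} (h : Rel k A x y) : toU k A x = toU k A y :=
  RingQuot.mkAlgHom_rel k h

theorem toU_ι_S (a : A) : toU k A (FreeAlgebra.ι k (Gen.S a)) = uS k a := rfl

theorem toU_ι_T (D : HSDer k A Δ) {α : MIdx p} (hα : α ∈ Δ) :
    toU k A (FreeAlgebra.ι k (Gen.T p Δ D α hα)) = uT D α := by
  rw [uT, varT, dif_pos hα]

theorem uT_of_notMem (D : HSDer k A Δ) {α : MIdx p} (hα : α ∉ Δ) : uT D α = 0 := by
  rw [uT, varT, dif_neg hα, map_zero]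

theorem uS_mul (a b : A) : uS k (a * b) = uS k a * uS k b := by
  rw [uS, toU_rel (Rel.S_mul a b), map_mul]
  rfl

theorem uS_zero : uS k (0 : A) = 0 := by
  have h := toU_rel (Rel.S_scalar (A := A) (0 : k))
  rwa [map_zero, map_zero, map_zero] at h

theorem uS_one : uS k (1 : A) = 1 := by
  have h := toU_rel (Rel.S_scalar (A := A) (1 : k))
  rwa [map_one, map_one, map_one] at h

theorem uT_mul (D E : HSDer k A Δ) {α : MIdx p} (hα : α ∈ Δ) :
    uT (D * E) α = ∑ b ∈ antidiagonal α, uT D b.1 * uT E b.2 := by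
  rw [uT, toU_rel (Rel.T_comp p Δ D E α hα), map_sum]
  exact Finset.sum_congr rfl fun b _ => map_mul _ _ _

theorem uT_mul_uS (D : HSDer k A Δ) {α : MIdx p} (hα : α ∈ Δ) (a : A) :
    uT D α * uS k a = ∑ b ∈ antidiagonal α, uS k (D b.1 a) * uT D b.2 := by
  rw [uT, uS, ← map_mul, toU_rel (Rel.T_S p Δ D α hα a), map_sum]
  exact Finset.sum_congr rfl fun b _ => map_mul _ _ _

theorem uT_bullet (φ : SubstMap A Δ N) (D : HSDer k A Δ) {β : MIdx r} (hβ : β ∈ N) :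
    uT (HSDer.bullet φ D) β = ∑ α ∈ Δ.upTo β.degree, uS k (φ.C β α) * uT D α := by
  rw [uT, toU_rel (Rel.T_subst p r Δ N φ D β hβ), map_sum]
  exact Finset.sum_congr rfl fun b _ => map_mul _ _ _

theorem uT_ofEmb_embDomain (e : Fin p ↪ Fin r)
    (h : ∀ α : MIdx p, α.embDomain e ∈ N → α ∈ Δ) (D : HSDer k A Δ) {α : MIdx p}
    (hα : α.embDomain e ∈ N) :
    uT (HSDer.bullet (SubstMap.ofEmb e h) D) (α.embDomain e) = uT D α := by
  rw [uT_bullet _ _ hα, sum_ofEmb_C e h α hα (fun a β => uS k a * uT D β)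
    fun β => by rw [uS_zero, zero_mul], uS_one, one_mul]

theorem uT_ofEmb_of_notMem_range (e : Fin p ↪ Fin r)
    (h : ∀ α : MIdx p, α.embDomain e ∈ N → α ∈ Δ) (D : HSDer k A Δ) {δ : MIdx r}
    (hr : δ ∉ Set.range (Finsupp.embDomain (M := ℕ) e)) :
    uT (HSDer.bullet (SubstMap.ofEmb e h) D) δ = 0 := by
  by_cases hδ : δ ∈ N
  · rw [uT_bullet _ _ hδ, sum_ofEmb_C_of_notMem_range e h hδ hr (fun a β => uS k a * uT D β)
      fun β => by rw [uS_zero, zero_mul]]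
  · exact uT_of_notMem _ hδ

/-- The principal co-ideal of the multi-indices `≤ γ`. -/
def Coideal.Iic (γ : MIdx p) : Coideal p := ⟨LowerSet.Iic γ, ⟨γ, LowerSet.mem_Iic_iff.2 le_rfl⟩⟩

theorem Coideal.mem_Iic {γ δ : MIdx p} : δ ∈ Coideal.Iic γ ↔ δ ≤ γ := LowerSet.mem_Iic_iff

theorem embDomain_refl (α : MIdx p) : α.embDomain (Function.Embedding.refl (Fin p)) = α := by
  rw [Finsupp.embDomain_eq_mapDomain]
  exact Finsupp.mapDomain_id

/-- The class of `T_{D,γ}` depends only on the `D_δ` with `δ ≤ γ`, and not on the co-ideal: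
truncate to the `δ ≤ γ`. -/
theorem uT_congr {Δ' : Coideal p} {D : HSDer k A Δ} {E : HSDer k A Δ'} {γ : MIdx p}
    (hγ : γ ∈ Δ) (hγ' : γ ∈ Δ') (h : ∀ δ ≤ γ, D δ = E δ) : uT D γ = uT E γ := by
  let i := Function.Embedding.refl (Fin p)
  have hΔ : ∀ α : MIdx p, α.embDomain i ∈ Coideal.Iic γ → α ∈ Δ := fun α hα => by
    rw [embDomain_refl, Coideal.mem_Iic] at hα
    exact Coideal.mem_of_le hα hγ
  have hΔ' : ∀ α : MIdx p, α.embDomain i ∈ Coideal.Iic γ → α ∈ Δ' := fun α hα => by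
    rw [embDomain_refl, Coideal.mem_Iic] at hα
    exact Coideal.mem_of_le hα hγ'
  have hi : γ.embDomain i ∈ Coideal.Iic γ := by
    rw [embDomain_refl, Coideal.mem_Iic]
  have heq : HSDer.bullet (SubstMap.ofEmb i hΔ) D = HSDer.bullet (SubstMap.ofEmb i hΔ') E := by
    ext1
    funext δ
    by_cases hδ : δ ∈ Coideal.Iic γ
    · rw [← embDomain_refl δ] at hδ ⊢
      rw [HSDer.bullet_ofEmb_embDomain _ _ _ hδ, HSDer.bullet_ofEmb_embDomain _ _ _ hδ]
      rw [embDomain_refl] at hδ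
      exact h δ (Coideal.mem_Iic.1 hδ)
    · rw [HSDer.eq_zero_of_notMem _ _ hδ, HSDer.eq_zero_of_notMem _ _ hδ]
  rw [← uT_ofEmb_embDomain i hΔ D hi, heq, uT_ofEmb_embDomain i hΔ' E hi]

theorem uT_zero (D : HSDer k A Δ) : uT D 0 = 1 := by
  rw [uT_congr (E := (1 : HSDer k A (Coideal.zero p))) Δ.zero_mem (Coideal.zero_mem _), uT,
    toU_rel (Rel.T_zero p), map_one]
  intro δ hδ
  rw [le_zero_iff.1 hδ, D.map_zero, HSDer.map_zero]

theorem uT_eq_zero (D : HSDer k A Δ) {γ : MIdx p} (h0 : γ ≠ 0)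
    (h : ∀ δ ≤ γ, δ ≠ 0 → D δ = 0) : uT D γ = 0 := by
  by_cases hγ : γ ∈ Δ
  · rw [uT_congr (E := (1 : HSDer k A Δ)) hγ hγ, uT,
      toU_rel (Rel.T_one p Δ γ hγ
        (Nat.pos_of_ne_zero fun hd => h0 ((Finsupp.degree_eq_zero_iff _).1 hd))), map_zero]
    intro δ hδ
    by_cases hδ0 : δ = 0
    · rw [hδ0, D.map_zero, HSDer.map_zero]
    · rw [h δ hδ hδ0, HSDer.one_apply_of_ne_zero hδ0]
  · exact uT_of_notMem D hγ

/-! ### The filtration -/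

theorem toU_ι_mem_filU (g : Gen k A) : toU k A (FreeAlgebra.ι k g) ∈ filU k A g.deg := by
  rw [filU_eq_span]
  exact Submodule.subset_span ⟨[g], by simp, by simp⟩

theorem filU_mono {d e : ℕ} (h : d ≤ e) : filU k A d ≤ filU k A e :=
  IsFiltration.mono (F := filU k A) (F_lt := filLtU k A) h

theorem filU_le_filLtU {d e : ℕ} (h : d < e) : filU k A d ≤ filLtU k A e :=
  le_iSup₂_of_le d h le_rfl

theorem filLtU_mono {d e : ℕ} (h : d ≤ e) : filLtU k A d ≤ filLtU k A e :=
  iSup₂_le fun _ hi => filU_le_filLtU (hi.trans_le h)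

theorem mul_mem_filU {d e : ℕ} {x y : UAlg k A} (hx : x ∈ filU k A d) (hy : y ∈ filU k A e) :
    x * y ∈ filU k A (d + e) := SetLike.GradedMul.mul_mem (A := filU k A) hx hy

/-- A lower bound `n` of `ℓ_α(D)` gives the upper bound `⌊|α| / n⌋` for the degree of `T_{D,α}`. -/
theorem uT_mem_filU (D : HSDer k A Δ) (α : MIdx p) {n : ℕ} (hn : 0 < n)
    (h : ∀ β ≤ α, β ≠ 0 → D β ≠ 0 → n ≤ β.degree) : uT D α ∈ filU k A (α.degree / n) := by
  by_cases hα : α ∈ Δ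
  · rw [← toU_ι_T D hα]
    refine filU_mono ?_ (toU_ι_mem_filU _)
    rw [Gen.deg]
    split_ifs with ht
    · exact Nat.zero_le _
    · refine Nat.div_le_div_left ?_ hn
      have := HSDer.natCast_le_ell.2 h
      rwa [← ENat.natCast_toNat ht, Nat.cast_le] at this
  · rw [uT_of_notMem D hα]
    exact zero_mem _

/-! ### Commutators of the generators -/

/-- In `[T_{D,α}, S_a] = ∑_{β ≠ 0} S_{D_β(a)} T_{D,α-β}` only the `β` with `|β| ≥ ℓ_α(D)`
contribute, so that the degree drops by at least one. -/
theorem commutator_uT_uS_mem (D : HSDer k A Δ) {α : MIdx p} (hα : α ∈ Δ) {n : ℕ} (hn : 0 < n)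
    (h : ∀ β ≤ α, β ≠ 0 → D β ≠ 0 → n ≤ β.degree) (a : A) :
    uT D α * uS k a - uS k a * uT D α ∈ filLtU k A (α.degree / n) := by
  classical
  have h0 : ((0, α) : MIdx p × MIdx p) ∈ antidiagonal α := mem_antidiagonal.2 (zero_add α)
  rw [uT_mul_uS D hα, ← Finset.add_sum_erase _ _ h0, D.map_zero, LinearMap.id_apply,
    add_sub_cancel_left]
  refine sum_mem fun b hb => ?_
  obtain ⟨hne, hb⟩ := Finset.mem_erase.1 hb
  have hs := mem_antidiagonal.1 hb
  have hb1 : b.1 ≠ 0 := by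
    intro hb1
    rw [hb1, zero_add] at hs
    exact hne (Prod.ext hb1 hs)
  by_cases hD : D b.1 = 0
  · rw [hD, LinearMap.zero_apply, uS_zero, zero_mul]
    exact zero_mem _
  have hle := h b.1 (fst_le_of_mem hb) hb1 hD
  have hdeg : b.1.degree + b.2.degree = α.degree := by rw [← map_add, hs]
  have hT := uT_mem_filU D b.2 hn fun β hβ => h β (hβ.trans (snd_le_of_mem hb))
  have hS : uS k (D b.1 a) ∈ filU k A 0 := toU_ι_mem_filU (Gen.S _)
  refine filU_le_filLtU ?_ (mul_mem_filU hS hT)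
  rw [zero_add]
  calc b.2.degree / n < (b.2.degree + n) / n := by rw [Nat.add_div_right _ hn]; omega
    _ ≤ α.degree / n := Nat.div_le_div_right (by omega)

variable (p q) in
/-- The inclusion of the first `p` variables. -/
abbrev embL : Fin p ↪ Fin (p + q) := Fin.castAddEmb q

variable (p q) in
/-- The inclusion of the last `q` variables. -/
abbrev embR : Fin q ↪ Fin (p + q) := Fin.natAddEmb p

/-- The multi-index `(α, β) ∈ ℕ^{p+q}` with components `α ∈ ℕ^p` and `β ∈ ℕ^q`. -/
noncomputable def pair (α : MIdx p) (β : MIdx q) : MIdx (p + q) :=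
  α.embDomain (embL p q) + β.embDomain (embR p q)

theorem pair_castAdd (α : MIdx p) (β : MIdx q) (i : Fin p) :
    pair α β (Fin.castAdd q i) = α i := by
  have h1 : α.embDomain (embL p q) (embL p q i) = α i := Finsupp.embDomain_apply_self _ _ _
  have h2 : β.embDomain (embR p q) (embL p q i) = 0 :=
    Finsupp.embDomain_of_notMem_range _ _ _ (by
      rintro ⟨j, hj⟩
      have := congrArg Fin.val hj
      simp at this
      omega)
  exact (congrArg₂ (· + ·) h1 h2).trans (add_zero _)

theorem pair_natAdd (α : MIdx p) (β : MIdx q) (j : Fin q) :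
    pair α β (Fin.natAdd p j) = β j := by
  have h1 : β.embDomain (embR p q) (embR p q j) = β j := Finsupp.embDomain_apply_self _ _ _
  have h2 : α.embDomain (embL p q) (embR p q j) = 0 :=
    Finsupp.embDomain_of_notMem_range _ _ _ (by
      rintro ⟨i, hi⟩
      have := congrArg Fin.val hi
      simp at this
      omega)
  exact (congrArg₂ (· + ·) h2 h1).trans (zero_add _)

theorem pair_le_pair {α α' : MIdx p} {β β' : MIdx q} :
    pair α' β' ≤ pair α β ↔ α' ≤ α ∧ β' ≤ β := by
  constructor
  · intro h
    refine ⟨fun i => ?_, fun j => ?_⟩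
    · simpa only [pair_castAdd] using h (Fin.castAdd q i)
    · simpa only [pair_natAdd] using h (Fin.natAdd p j)
  · rintro ⟨h1, h2⟩ i
    induction i using Fin.addCases with
    | left i => simpa only [pair_castAdd] using h1 i
    | right j => simpa only [pair_natAdd] using h2 j

theorem pair_inj {α α' : MIdx p} {β β' : MIdx q} :
    pair α' β' = pair α β ↔ α' = α ∧ β' = β := by
  rw [le_antisymm_iff, pair_le_pair, pair_le_pair, le_antisymm_iff, le_antisymm_iff]
  tauto

theorem exists_eq_pair (δ : MIdx (p + q)) : ∃ (α : MIdx p) (β : MIdx q), δ = pair α β := by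
  refine ⟨Finsupp.equivFunOnFinite.symm fun i => δ (Fin.castAdd q i),
    Finsupp.equivFunOnFinite.symm fun j => δ (Fin.natAdd p j), ?_⟩
  ext i
  induction i using Fin.addCases with
  | left i => rw [pair_castAdd]; rfl
  | right j => rw [pair_natAdd]; rfl

theorem pair_zero_right (α : MIdx p) : pair α (0 : MIdx q) = α.embDomain (embL p q) := by
  rw [pair, Finsupp.embDomain_zero, add_zero]

theorem pair_zero_left (β : MIdx q) : pair (0 : MIdx p) β = β.embDomain (embR p q) := by
  rw [pair, Finsupp.embDomain_zero, zero_add]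

theorem pair_add_pair (α α' : MIdx p) (β β' : MIdx q) :
    pair α β + pair α' β' = pair (α + α') (β + β') := by
  simp only [pair, Finsupp.embDomain_add]
  abel

theorem degree_pair (α : MIdx p) (β : MIdx q) : (pair α β).degree = α.degree + β.degree := by
  have h := map_add Finsupp.degree (α.embDomain (embL p q)) (β.embDomain (embR p q))
  rw [degree_embDomain, degree_embDomain] at h
  exact h

theorem sum_antidiagonal_swap {M : Type*} [AddCommMonoid M] (γ : MIdx r)
    (f : MIdx r × MIdx r → M) :
    ∑ b ∈ antidiagonal γ, f b = ∑ b ∈ antidiagonal γ, f b.swap :=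
  Finset.sum_equiv (Equiv.prodComm _ _)
    (fun b => by simp only [mem_antidiagonal, Equiv.prodComm_apply, Prod.fst_swap, Prod.snd_swap,
      add_comm]) fun _ _ => rfl

/-- If `f` vanishes unless its first argument involves only the first `p` variables and its second
only the last `q`, its sum over the antidiagonal of `(α, β)` has a single term: `(α, β)` splits in
only one such way. -/
theorem sum_antidiagonal_pair {M : Type*} [AddCommMonoid M] (α : MIdx p) (β : MIdx q)
    (f : MIdx (p + q) × MIdx (p + q) → M)
    (h1 : ∀ b, b.1 ∉ Set.range (Finsupp.embDomain (M := ℕ) (embL p q)) → f b = 0)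
    (h2 : ∀ b, b.2 ∉ Set.range (Finsupp.embDomain (M := ℕ) (embR p q)) → f b = 0) :
    ∑ b ∈ antidiagonal (pair α β), f b =
      f (α.embDomain (embL p q), β.embDomain (embR p q)) := by
  refine Finset.sum_eq_single (α.embDomain (embL p q), β.embDomain (embR p q))
    (fun b hb hne => ?_) fun h => ?_
  · by_contra hf
    obtain ⟨α', h1'⟩ := not_not.1 fun h => hf (h1 b h)
    obtain ⟨β', h2'⟩ := not_not.1 fun h => hf (h2 b h)
    have hs : b.1 + b.2 = pair α β := mem_antidiagonal.1 hb
    rw [← h1', ← h2'] at hs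
    obtain ⟨hα, hβ⟩ := pair_inj.1 (show pair α' β' = pair α β from hs)
    refine hne (Prod.ext ?_ ?_)
    · rw [← h1', hα]
    · rw [← h2', hβ]
  · refine absurd (mem_antidiagonal.2 ?_) h
    rw [pair]

/-- The arithmetic behind the drop of the degree. Writing `m = ⌊a / d⌋` and `n = ⌊b / e⌋`, both at
least `1`, one has `a + b < (m + 1) d + (n + 1) e ≤ (m + n) (d + e)`. -/
theorem add_div_add_lt {a b a' b' d e : ℕ} (hd : 0 < d) (he : 0 < e) (ha : d ≤ a) (hb : e ≤ b) :
    b' / e + a' / d + (a + b) / (d + e) < (a + a') / d + (b + b') / e := by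
  have h1 : a / d + a' / d ≤ (a + a') / d := Nat.div_add_div_le_add_div
  have h2 : b / e + b' / e ≤ (b + b') / e := Nat.div_add_div_le_add_div
  have h3 : 1 ≤ a / d := (Nat.one_le_div_iff hd).2 ha
  have h4 : 1 ≤ b / e := (Nat.one_le_div_iff he).2 hb
  have h5 : (a + b) / (d + e) < a / d + b / e := by
    rw [Nat.div_lt_iff_lt_mul (by omega)]
    have h6 := Nat.lt_div_mul_add (a := a) hd
    have h7 := Nat.lt_div_mul_add (a := b) he
    nlinarith [Nat.mul_le_mul_right d h4, Nat.mul_le_mul_right e h3]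
  omega

/-- Both `D` and `E` are viewed as Hasse-Schmidt derivations `D'`, `E'` in the `p + q` variables
and multiplied there: `T_{D,α} T_{E,β} = T_{D'E',(α,β)}` and `T_{E,β} T_{D,α} = T_{E'D',(α,β)}`.
Write `D'E' = E'D'F`. The components of `F` vanish on the multi-indices `(a, b) ≠ 0` with
`|a| < ℓ_α(D)` or `|b| < ℓ_β(E)`, where `D'E'` and `E'D'` agree. Hence
`ℓ(F) ≥ ℓ_α(D) + ℓ_β(E)`, and the expansion of `T_{E'D'F,(α,β)}` shows that the commutator has
smaller degree. -/
theorem commutator_uT_uT_mem {N : Coideal q} (D : HSDer k A Δ) (E : HSDer k A N) {α : MIdx p}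
    (hα : α ∈ Δ) {β : MIdx q} (hβ : β ∈ N) {d e : ℕ} (hd : 0 < d) (he : 0 < e)
    (hD : ∀ α' ≤ α, α' ≠ 0 → D α' ≠ 0 → d ≤ α'.degree)
    (hE : ∀ β' ≤ β, β' ≠ 0 → E β' ≠ 0 → e ≤ β'.degree) :
    uT D α * uT E β - uT E β * uT D α ∈ filLtU k A (α.degree / d + β.degree / e) := by
  classical
  let Γ : Coideal (p + q) := Coideal.Iic (pair α β)
  have hΓ : ∀ {a b}, pair a b ∈ Γ ↔ a ≤ α ∧ b ≤ β := Coideal.mem_Iic.trans pair_le_pair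
  have hL : ∀ a : MIdx p, a.embDomain (embL p q) ∈ Γ → a ∈ Δ := fun a ha => by
    rw [← pair_zero_right, hΓ] at ha
    exact Coideal.mem_of_le ha.1 hα
  have hR : ∀ b : MIdx q, b.embDomain (embR p q) ∈ Γ → b ∈ N := fun b hb => by
    rw [← pair_zero_left, hΓ] at hb
    exact Coideal.mem_of_le hb.2 hβ
  have hLmem : ∀ {a b}, pair a b ∈ Γ → a.embDomain (embL p q) ∈ Γ := fun h => by
    rw [← pair_zero_right, hΓ]
    exact ⟨(hΓ.1 h).1, zero_le⟩
  have hRmem : ∀ {a b}, pair a b ∈ Γ → b.embDomain (embR p q) ∈ Γ := fun h => by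
    rw [← pair_zero_left, hΓ]
    exact ⟨zero_le, (hΓ.1 h).2⟩
  let D' : HSDer k A Γ := HSDer.bullet (SubstMap.ofEmb (embL p q) hL) D
  let E' : HSDer k A Γ := HSDer.bullet (SubstMap.ofEmb (embR p q) hR) E
  have hDE : ∀ a b, pair a b ∈ Γ → (D' * E') (pair a b) = D a ∘ₗ E b := by
    intro a b h
    rw [HSDer.mul_apply _ _ h, sum_antidiagonal_pair a b fun x => D' x.1 ∘ₗ E' x.2]
    · rw [HSDer.bullet_ofEmb_embDomain _ _ _ (hLmem h),
        HSDer.bullet_ofEmb_embDomain _ _ _ (hRmem h)]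
    · intro x hx
      rw [HSDer.bullet_ofEmb_of_notMem_range _ _ _ hx, LinearMap.zero_comp]
    · intro x hx
      rw [HSDer.bullet_ofEmb_of_notMem_range _ _ _ hx, LinearMap.comp_zero]
  have hED : ∀ a b, pair a b ∈ Γ → (E' * D') (pair a b) = E b ∘ₗ D a := by
    intro a b h
    rw [HSDer.mul_apply _ _ h, sum_antidiagonal_swap,
      sum_antidiagonal_pair a b fun x => E' x.swap.1 ∘ₗ D' x.swap.2]
    · rw [Prod.swap_prod_mk, HSDer.bullet_ofEmb_embDomain _ _ _ (hLmem h),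
        HSDer.bullet_ofEmb_embDomain _ _ _ (hRmem h)]
    · intro x hx
      rw [Prod.snd_swap, HSDer.bullet_ofEmb_of_notMem_range _ _ _ hx, LinearMap.comp_zero]
    · intro x hx
      rw [Prod.fst_swap, HSDer.bullet_ofEmb_of_notMem_range _ _ _ hx, LinearMap.zero_comp]
  have hTDE : uT (D' * E') (pair α β) = uT D α * uT E β := by
    have h : pair α β ∈ Γ := hΓ.2 ⟨le_rfl, le_rfl⟩
    rw [uT_mul _ _ h, sum_antidiagonal_pair α β fun x => uT D' x.1 * uT E' x.2]
    · rw [uT_ofEmb_embDomain _ _ _ (hLmem h), uT_ofEmb_embDomain _ _ _ (hRmem h)]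
    · intro x hx
      rw [uT_ofEmb_of_notMem_range _ _ _ hx, zero_mul]
    · intro x hx
      rw [uT_ofEmb_of_notMem_range _ _ _ hx, mul_zero]
  have hTED : ∀ a b, pair a b ∈ Γ → uT (E' * D') (pair a b) = uT E b * uT D a := by
    intro a b h
    rw [uT_mul _ _ h, sum_antidiagonal_swap,
      sum_antidiagonal_pair a b fun x => uT E' x.swap.1 * uT D' x.swap.2]
    · rw [Prod.swap_prod_mk, uT_ofEmb_embDomain _ _ _ (hLmem h),
        uT_ofEmb_embDomain _ _ _ (hRmem h)]
    · intro x hx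
      rw [Prod.snd_swap, uT_ofEmb_of_notMem_range _ _ _ hx, mul_zero]
    · intro x hx
      rw [Prod.fst_swap, uT_ofEmb_of_notMem_range _ _ _ hx, zero_mul]
  obtain ⟨F, hF⟩ := HSDer.exists_mul_eq (D' * E') (E' * D')
  -- Below such a pair one of `D`, `E` is trivial, so that `D'E'` and `E'D'` agree there.
  have hFzero : ∀ a b, pair a b ∈ Γ → (a.degree < d ∨ b.degree < e) →
      ∀ δ ≤ pair a b, δ ≠ 0 → F δ = 0 := by
    intro a b hab hlt δ hδ h0
    refine HSDer.eq_zero_of_mul_agree (E := E' * D') hab (fun ε hε => ?_) hδ h0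
    obtain ⟨a', b', rfl⟩ := exists_eq_pair ε
    have hΓ' : pair a' b' ∈ Γ := Coideal.mem_of_le hε hab
    obtain ⟨ha', hb'⟩ := pair_le_pair.1 hε
    rw [hF, hDE _ _ hΓ', hED _ _ hΓ']
    obtain ⟨ha'', hb''⟩ := hΓ.1 hΓ'
    rcases hlt with hlt | hlt
    · by_cases h : a' = 0
      · rw [h, D.map_zero, LinearMap.comp_id, LinearMap.id_comp]
      · have : D a' = 0 := by
          by_contra hne
          exact absurd (hD a' ha'' h hne) (not_le.2 ((Finsupp.degree_mono ha').trans_lt hlt))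
        rw [this, LinearMap.comp_zero, LinearMap.zero_comp]
    · by_cases h : b' = 0
      · rw [h, E.map_zero, LinearMap.comp_id, LinearMap.id_comp]
      · have : E b' = 0 := by
          by_contra hne
          exact absurd (hE b' hb'' h hne) (not_le.2 ((Finsupp.degree_mono hb').trans_lt hlt))
        rw [this, LinearMap.comp_zero, LinearMap.zero_comp]
  -- By the previous step both components of such a `δ` are large, so that the bounds add up.
  have hFell : ∀ δ ∈ Γ, δ ≠ 0 → F δ ≠ 0 → d + e ≤ δ.degree := by
    intro δ hδ h0 hne
    obtain ⟨a, b, rfl⟩ := exists_eq_pair δ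
    by_contra hlt
    rw [degree_pair] at hlt
    exact hne (hFzero a b hδ (by omega) _ le_rfl h0)
  have hmem : pair α β ∈ Γ := hΓ.2 ⟨le_rfl, le_rfl⟩
  have h0 : ((pair α β, 0) : MIdx (p + q) × MIdx (p + q)) ∈ antidiagonal (pair α β) :=
    mem_antidiagonal.2 (add_zero _)
  rw [← hTDE, ← hF, uT_mul _ _ hmem, ← Finset.add_sum_erase _ _ h0, uT_zero, mul_one,
    hTED α β hmem, add_sub_cancel_left]
  -- The term with `F_0 = 1` was `T_{E,β} T_{D,α}`; each of the others has smaller degree.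
  refine sum_mem fun x hx => ?_
  obtain ⟨hne, hx⟩ := Finset.mem_erase.1 hx
  obtain ⟨x, y⟩ := x
  obtain ⟨a', b', rfl⟩ := exists_eq_pair x
  obtain ⟨a, b, rfl⟩ := exists_eq_pair y
  have h1 : pair a' b' ∈ Γ := Coideal.mem_of_le (fst_le_of_mem hx) hmem
  have h2 : pair a b ∈ Γ := Coideal.mem_of_le (snd_le_of_mem hx) hmem
  have hs : pair a' b' + pair a b = pair α β := mem_antidiagonal.1 hx
  have hne0 : pair a b ≠ 0 := by
    intro h
    rw [h, add_zero] at hs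
    exact hne (Prod.ext hs h)
  change uT (E' * D') (pair a' b') * uT F (pair a b) ∈ _
  by_cases hlt : a.degree < d ∨ b.degree < e
  · rw [uT_eq_zero F hne0 (hFzero a b h2 hlt), mul_zero]
    exact zero_mem _
  push Not at hlt
  rw [hTED a' b' h1]
  obtain ⟨ha', hb'⟩ := hΓ.1 h1
  have hmD := uT_mem_filU D a' hd fun γ hγ => hD γ (hγ.trans ha')
  have hmE := uT_mem_filU E b' he fun γ hγ => hE γ (hγ.trans hb')
  have hmF := uT_mem_filU F (pair a b) (n := d + e) (by omega)
    fun γ hγ => hFell γ (Coideal.mem_of_le hγ h2)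
  refine filU_le_filLtU ?_ (mul_mem_filU (mul_mem_filU hmE hmD) hmF)
  rw [pair_add_pair] at hs
  obtain ⟨hs1, hs2⟩ := pair_inj.1 hs
  rw [degree_pair, ← hs1, ← hs2, map_add, map_add, add_comm a'.degree, add_comm b'.degree]
  exact add_div_add_lt hd he hlt.1 hlt.2

/-- When `ℓ_α(D) = ∞`, the class of `T_{D,α}` is `0` or `1`. -/
theorem uT_commute_of_ell_eq_top {D : HSDer k A Δ} {α : MIdx p} (h : D.ell α = ⊤)
    (x : UAlg k A) : uT D α * x = x * uT D α := by
  by_cases h0 : α = 0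
  · rw [h0, uT_zero, one_mul, mul_one]
  · rw [uT_eq_zero D h0 (HSDer.ell_eq_top.1 h), zero_mul, mul_zero]

theorem HSDer.toNat_ell_pos_and_le {D : HSDer k A Δ} {α : MIdx p} (h : D.ell α ≠ ⊤) :
    0 < (D.ell α).toNat ∧
      ∀ β ≤ α, β ≠ 0 → D β ≠ 0 → (D.ell α).toNat ≤ β.degree := by
  refine ⟨Nat.pos_of_ne_zero fun h0 => ?_,
    HSDer.natCast_le_ell.1 (ENat.natCast_toNat h).le⟩
  rcases ENat.toNat_eq_zero.1 h0 with h0 | h0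
  · exact HSDer.ell_ne_zero D α h0
  · exact h h0

theorem commutator_gen_mem (g h : Gen k A) :
    toU k A (FreeAlgebra.ι k g) * toU k A (FreeAlgebra.ι k h) -
      toU k A (FreeAlgebra.ι k h) * toU k A (FreeAlgebra.ι k g) ∈ filLtU k A (g.deg + h.deg) := by
  have hTS : ∀ {p : ℕ} {Δ : Coideal p} (D : HSDer k A Δ) (α : MIdx p) (hα : α ∈ Δ) (a : A),
      uT D α * uS k a - uS k a * uT D α ∈ filLtU k A (Gen.T p Δ D α hα).deg := by
    intro p Δ D α hα a
    by_cases ht : D.ell α = ⊤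
    · rw [uT_commute_of_ell_eq_top ht, sub_self]
      exact zero_mem _
    · obtain ⟨hn, hle⟩ := HSDer.toNat_ell_pos_and_le ht
      rw [Gen.deg, if_neg ht]
      exact commutator_uT_uS_mem D hα hn hle a
  cases g with
  | S a =>
    cases h with
    | S b =>
      rw [toU_ι_S, toU_ι_S, ← uS_mul, ← uS_mul, mul_comm, sub_self]
      exact zero_mem _
    | T p Δ D α hα =>
      rw [toU_ι_S, toU_ι_T, ← neg_sub, neg_mem_iff]
      exact filLtU_mono (Nat.le_add_left _ _) (hTS D α hα a)
  | T p Δ D α hα =>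
    cases h with
    | S b =>
      rw [toU_ι_S, toU_ι_T]
      exact hTS D α hα b
    | T q N E β hβ =>
      rw [toU_ι_T, toU_ι_T]
      by_cases hD : D.ell α = ⊤
      · rw [uT_commute_of_ell_eq_top hD, sub_self]
        exact zero_mem _
      by_cases hE : E.ell β = ⊤
      · rw [uT_commute_of_ell_eq_top hE, sub_self]
        exact zero_mem _
      obtain ⟨hd, hdle⟩ := HSDer.toNat_ell_pos_and_le hD
      obtain ⟨he, hele⟩ := HSDer.toNat_ell_pos_and_le hE
      rw [Gen.deg, Gen.deg, if_neg hD, if_neg hE]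
      exact commutator_uT_uT_mem D E hα hβ hd he hdle hele

/-! ### Commutativity of the associated graded ring -/

/-- The commutator with a fixed element is a derivation, which reduces monomials to generators. -/
theorem commutator_monomial_mem (l m : List (Gen k A)) :
    (l.map fun x => toU k A (FreeAlgebra.ι k x)).prod *
        (m.map fun x => toU k A (FreeAlgebra.ι k x)).prod -
      (m.map fun x => toU k A (FreeAlgebra.ι k x)).prod *
        (l.map fun x => toU k A (FreeAlgebra.ι k x)).prod ∈
      filLtU k A ((l.map Gen.deg).sum + (m.map Gen.deg).sum) := by
  have hmem : ∀ l : List (Gen k A), (l.map fun x => toU k A (FreeAlgebra.ι k x)).prod ∈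
      filU k A (l.map Gen.deg).sum := fun l => by
    rw [filU_eq_span]
    exact Submodule.subset_span ⟨l, le_rfl, rfl⟩
  induction l with
  | nil => simp
  | cons g l ih =>
    have hg : toU k A (FreeAlgebra.ι k g) * (m.map fun x => toU k A (FreeAlgebra.ι k x)).prod -
        (m.map fun x => toU k A (FreeAlgebra.ι k x)).prod * toU k A (FreeAlgebra.ι k g) ∈
        filLtU k A (g.deg + (m.map Gen.deg).sum) := by
      clear ih
      induction m with
      | nil => simp
      | cons h m ih =>
        simp only [List.map_cons, List.prod_cons, List.sum_cons]
        have h1 := lt_mul_mem (F := filU k A) (commutator_gen_mem g h) (hmem m)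
        have h2 := mul_lt_mem (toU_ι_mem_filU h) ih
        rw [add_assoc] at h1
        rw [add_left_comm] at h2
        convert add_mem h1 h2 using 1
        noncomm_ring
    simp only [List.map_cons, List.prod_cons, List.sum_cons]
    have h1 := mul_lt_mem (toU_ι_mem_filU g) ih
    have h2 := lt_mul_mem (F := filU k A) hg (hmem l)
    rw [← add_assoc] at h1
    rw [add_right_comm] at h2
    convert add_mem h1 h2 using 1
    noncomm_ring

theorem commutator_mem {i j : ℕ} {x y : UAlg k A} (hx : x ∈ filU k A i) (hy : y ∈ filU k A j) :
    x * y - y * x ∈ filLtU k A (i + j) := by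
  rw [filU_eq_span] at hx hy
  induction hx, hy using Submodule.span_induction₂ with
  | mem_mem x y hx hy =>
    obtain ⟨l, hl, rfl⟩ := hx
    obtain ⟨m, hm, rfl⟩ := hy
    exact filLtU_mono (add_le_add hl hm) (commutator_monomial_mem l m)
  | zero_left y hy => simp
  | zero_right x hx => simp
  | add_left x y z hx hy hz h1 h2 =>
    convert add_mem h1 h2 using 1
    noncomm_ring
  | add_right x y z hx hy hz h1 h2 =>
    convert add_mem h1 h2 using 1
    noncomm_ring
  | smul_left c x y hx hy h =>
    rw [smul_mul_assoc, mul_smul_comm, ← smul_sub]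
    exact Submodule.smul_mem _ _ h
  | smul_right c x y hx hy h =>
    rw [smul_mul_assoc, mul_smul_comm, ← smul_sub]
    exact Submodule.smul_mem _ _ h

end Enveloping

section Gr

variable {k : Type u} {R : Type v} [CommRing k] [Ring R] [Algebra k R]
  (F Flt : ℕ → Submodule k R) [IsRingFiltration F Flt]

/-- The associated graded ring is commutative if commutators have smaller degree. -/
theorem gr_mul_comm
    (h : ∀ {i j : ℕ} {x y : R}, x ∈ F i → y ∈ F j → x * y - y * x ∈ Flt (i + j))
    (x y : Gr F Flt) : x * y = y * x := by
  induction x using DirectSum.induction_on with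
  | zero => rw [zero_mul, mul_zero]
  | add x x' hx hx' => rw [add_mul, mul_add, hx, hx']
  | of i a =>
    induction y using DirectSum.induction_on with
    | zero => rw [zero_mul, mul_zero]
    | add y y' hy hy' => rw [add_mul, mul_add, hy, hy']
    | of j b =>
      obtain ⟨a, rfl⟩ := GrPiece.mk_surjective F Flt _ a
      obtain ⟨b, rfl⟩ := GrPiece.mk_surjective F Flt _ b
      rw [DirectSum.of_mul_of, DirectSum.of_mul_of]
      refine DirectSum.of_eq_of_gradedMonoid_eq ?_
      have hba : (b : R) * a ∈ F (i + j) := by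
        rw [add_comm]
        exact SetLike.GradedMul.mul_mem b.2 a.2
      have h1 : GrPiece.mk F Flt (i + j) ⟨a * b, SetLike.GradedMul.mul_mem a.2 b.2⟩ =
          GrPiece.mk F Flt (i + j) ⟨b * a, hba⟩ := by
        rw [← sub_eq_zero, ← map_sub, GrPiece.mk_eq_zero]
        exact h a.2 b.2
      refine (congrArg (GradedMonoid.mk (i + j)) h1).trans ?_
      exact GrPiece.mk_eq_of F Flt (add_comm i j) _ _ rfl

end Gr

end HSEnv

theorem mainTheorem3 {k : Type*} {A : Type*} [CommRing k] [CommRing A] [Algebra k A] :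
    (∀ x y : HSEnv.GrU k A, x * y = y * x) ∧
    (∀ g h : HSEnv.Gen k A,
      HSEnv.toU k A (FreeAlgebra.ι k g) * HSEnv.toU k A (FreeAlgebra.ι k h) -
        HSEnv.toU k A (FreeAlgebra.ι k h) * HSEnv.toU k A (FreeAlgebra.ι k g) ∈
          HSEnv.filLtU k A (g.deg + h.deg)) :=
  ⟨HSEnv.gr_mul_comm _ _ HSEnv.commutator_mem, HSEnv.commutator_gen_mem⟩
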